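/- Fix non-negative integers $K, L$ and a real $M>0$. For each $n$ let $D, D'$ be probability distributions on $\mathbb{R}$ and consider the following random market with $n$ students and $m=\lfloor Mn\rfloor$ universities. Each student independently draws a uniformly random preference order over the universities and applies to the $K$ universities she likes best (she ranks being unmatched directly after them). A university $u$ observes an independent signal for every student, drawn from $D$ if $u$ is the student's favourite university and from $D'$ otherwise, and ranks the students in decreasing order of signal, equal signals being ordered by an independent uniformly random order. Every university has $L$ seats and prefers any student to an empty seat. A matching assigns each student to at most one university and at most $L$ students to each university; it is stable if no student is assigned to a university to which she did not apply, and if there is no pair $(s,u)$ such that $s$ prefers $u$ to her own assignment while $u$ has an empty seat or prefers $s$ to one of its students. Then any two stable matchings are identical except for an $o(1)$ fraction of the students, with probability $1-o(1)$ as $n\to\infty$. Precisely: there is a sequence $\delta_n\to 0$, depending only on $K, L, M$, such that for all $n$ and all $D, D'$, with probability at least $1-\delta_n$, any two stable matchings of the market assign all but at most $\delta_n n$ students identically. In particular, for all $n$ and all $D,D'$, with probability at least $1-\delta_n$, the matchings produced by the school-proposing and by the student-proposing deferred-acceptance algorithm assign all but at most $\delta_n n$ students identically. -/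

import Mathlib

open Filter Topology MeasureTheory ProbabilityTheory

namespace MatchingMarket

/-- A two-sided many-to-one market with students `Fin n` and universities `Fin m`. Every student has
a strict preference order over `Option (Fin m)`, where `none` is the option of having no match, so
`studentPrefers s a b` says that `s` strictly prefers `a` to `b`. Every university has a strict
preference order over the students, ranks every student above an empty seat, and has `capacity`
seats. -/
structure Market (n m : ℕ) where
  studentPrefers : Fin n → Option (Fin m) → Option (Fin m) → Prop
  studentPrefers_order : ∀ s, IsStrictTotalOrder (Option (Fin m)) (studentPrefers s)
  schoolPrefers : Fin m → Fin n → Fin n → Prop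
  schoolPrefers_order : ∀ u, IsStrictTotalOrder (Fin n) (schoolPrefers u)
  capacity : ℕ

namespace Market

variable {n m : ℕ}

/-- The student `s` applies to `u`: she ranks `u` above being unmatched. -/
def Applies (I : Market n m) (s : Fin n) (u : Fin m) : Prop :=
  I.studentPrefers s (some u) none

/-- An assignment of each student to at most one university is a matching if no university gets
more students than it has seats. -/
def IsMatching (I : Market n m) (μ : Fin n → Option (Fin m)) : Prop :=
  ∀ u, {s | μ s = some u}.ncard ≤ I.capacity

/-- `(s, u)` is a blocking pair: `s` prefers `u` to her partner (possibly `none`), and `u` has an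
empty seat or prefers `s` to one of its students. -/
def Blocks (I : Market n m) (μ : Fin n → Option (Fin m)) (s : Fin n) (u : Fin m) : Prop :=
  I.studentPrefers s (some u) (μ s) ∧
    ({t | μ t = some u}.ncard < I.capacity ∨ ∃ t, μ t = some u ∧ I.schoolPrefers u s t)

/-- Stable matchings: no student prefers being unmatched to her partner, and there is no blocking
pair. -/
def IsStable (I : Market n m) (μ : Fin n → Option (Fin m)) : Prop :=
  I.IsMatching μ ∧ (∀ s, ¬ I.studentPrefers s none (μ s)) ∧ ∀ s u, ¬ I.Blocks μ s u

/-! ### Student-proposing deferred acceptance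

A state is the set `R` of the pairs `(s, u)` such that `u` has rejected `s` so far. -/

/-- In state `R`, student `s` proposes to (or is held by) `u`: this is her favourite university
among those that she applies to and that have not rejected her. -/
def Proposes (I : Market n m) (R : Set (Fin n × Fin m)) (s : Fin n) (u : Fin m) : Prop :=
  I.Applies s u ∧ (s, u) ∉ R ∧
    ∀ v, v ≠ u → (s, v) ∉ R → I.studentPrefers s (some u) (some v)

/-- One round: every university keeps its favourite `capacity` students among those that propose
to it and rejects the others. -/
def studentRound (I : Market n m) (R : Set (Fin n × Fin m)) : Set (Fin n × Fin m) :=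
  R ∪ {p | I.Proposes R p.1 p.2 ∧
    I.capacity ≤ {t | I.Proposes R t p.2 ∧ I.schoolPrefers p.2 t p.1}.ncard}

/-- All rejections made in the course of the algorithm. -/
def studentRejections (I : Market n m) : Set (Fin n × Fin m) :=
  ⋃ k : ℕ, I.studentRound^[k] ∅

open Classical in
/-- The matching produced by student-proposing deferred acceptance: each student is with the
university that holds her when no more rejections occur. -/
noncomputable def studentDA (I : Market n m) (s : Fin n) : Option (Fin m) :=
  if h : ∃ u, I.Proposes I.studentRejections s u then some h.choose else none

/-! ### School-proposing deferred acceptance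

A state is the set `R` of the pairs `(s, u)` such that `s` has rejected an offer of `u` so far. -/

/-- In state `R`, university `u` offers a seat to `s`: among the applicants to `u` that have not
rejected it, `s` is one of the favourite `capacity` ones. -/
def Offers (I : Market n m) (R : Set (Fin n × Fin m)) (u : Fin m) (s : Fin n) : Prop :=
  I.Applies s u ∧ (s, u) ∉ R ∧
    {t | I.Applies t u ∧ (t, u) ∉ R ∧ I.schoolPrefers u t s}.ncard < I.capacity

/-- One round: every student rejects all but her favourite among the offers that she has. -/
def schoolRound (I : Market n m) (R : Set (Fin n × Fin m)) : Set (Fin n × Fin m) :=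
  R ∪ {p | I.Offers R p.2 p.1 ∧
    ∃ v, I.Offers R v p.1 ∧ I.studentPrefers p.1 (some v) (some p.2)}

/-- All rejections made in the course of the algorithm. -/
def schoolRejections (I : Market n m) : Set (Fin n × Fin m) :=
  ⋃ k : ℕ, I.schoolRound^[k] ∅

open Classical in
/-- The matching produced by school-proposing deferred acceptance: each student is with the
university whose offer she holds when no more rejections occur. -/
noncomputable def schoolDA (I : Market n m) (s : Fin n) : Option (Fin m) :=
  if h : ∃ u, I.Offers I.schoolRejections u s then some h.choose else none

end Market

/-- The number of students that two assignments treat differently. -/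
noncomputable def disagreement {n m : ℕ} (μ ν : Fin n → Option (Fin m)) : ℕ :=
  {s | μ s ≠ ν s}.ncard

/-! ### The random model -/

instance permMeasurableSpace (k : ℕ) : MeasurableSpace (Equiv.Perm (Fin k)) := ⊤

/-- Everything that is drawn at random.
* `pref s u` is the place of `u` in the preference list of `s` (place `0` is the favourite);
* `sig u s = (x, y)`: if `u` is the favourite of `s`, then `u` observes the signal `x` for `s`, and
  otherwise the signal `y`;
* `tie u` is the order in which `u` ranks students whose signals are equal. -/
abbrev Outcome (n m : ℕ) : Type :=
  (Fin n → Equiv.Perm (Fin m)) × (Fin m → Fin n → ℝ × ℝ) × (Fin m → Equiv.Perm (Fin n))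

/-- The law of the model: the preference profile of the students is uniform over all profiles (so
the students are independent, each with a uniform list), the signals are independent, the first
components with law `D` and the second ones with law `D'`, and the tie-breaking orders are
independent and uniform. The three groups are independent of each other. -/
noncomputable def law (D D' : Measure ℝ) (n m : ℕ) : Measure (Outcome n m) :=
  (uniformOn (Set.univ : Set (Fin n → Equiv.Perm (Fin m)))).prod
    ((Measure.pi fun _ : Fin m => Measure.pi fun _ : Fin n => D.prod D').prod
      (uniformOn (Set.univ : Set (Fin m → Equiv.Perm (Fin n)))))

namespace Outcome

variable {n m : ℕ}

/-- The place of an option in the list of `s` once `none` has been inserted directly after her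
favourite `K` universities. -/
def place (ω : Outcome n m) (K : ℕ) (s : Fin n) : Option (Fin m) → ℕ
  | none => K
  | some u => if (ω.1 s u : ℕ) < K then (ω.1 s u : ℕ) else (ω.1 s u : ℕ) + 1

/-- The signal that `u` observes for `s`. -/
noncomputable def signal (ω : Outcome n m) (u : Fin m) (s : Fin n) : ℝ :=
  if (ω.1 s u : ℕ) = 0 then (ω.2.1 u s).1 else (ω.2.1 u s).2

/-- `u` ranks the students in decreasing order of signal, ties being broken by `tie u`. -/
def Ranks (ω : Outcome n m) (u : Fin m) (s t : Fin n) : Prop :=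
  ω.signal u t < ω.signal u s ∨ (ω.signal u t = ω.signal u s ∧ ω.2.2 u s < ω.2.2 u t)

theorem place_injective (ω : Outcome n m) (K : ℕ) (s : Fin n) :
    Function.Injective (ω.place K s) := by
  intro a b h
  rcases a with _ | u <;> rcases b with _ | v
  · rfl
  · simp only [place] at h
    split_ifs at h <;> omega
  · simp only [place] at h
    split_ifs at h <;> omega
  · have h2 : (ω.1 s u : ℕ) = (ω.1 s v : ℕ) := by
      simp only [place] at h
      split_ifs at h <;> omega
    rw [(ω.1 s).injective (Fin.ext h2)]

/-- The market in which every student applies to her favourite `K` universities and every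
university has `L` seats. -/
noncomputable def market (ω : Outcome n m) (K L : ℕ) : Market n m where
  studentPrefers s a b := ω.place K s a < ω.place K s b
  studentPrefers_order s :=
    { trichotomous := fun _ _ h1 h2 =>
        ω.place_injective K s (le_antisymm (not_lt.1 h2) (not_lt.1 h1))
      irrefl := fun _ => lt_irrefl _
      trans := fun _ _ _ h1 h2 => lt_trans h1 h2 }
  schoolPrefers := ω.Ranks
  schoolPrefers_order u :=
    { trichotomous := fun a b h1 h2 => by
        simp only [Ranks, not_or, not_and, not_lt] at h1 h2
        have h3 := le_antisymm h1.1 h2.1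
        exact (ω.2.2 u).injective (le_antisymm (h2.2 h3) (h1.2 h3.symm))
      irrefl := fun a h => by
        rcases h with h | h
        · exact lt_irrefl _ h
        · exact lt_irrefl _ h.2
      trans := fun a b c h1 h2 => by
        rcases h1 with h1 | ⟨h1, h1'⟩ <;> rcases h2 with h2 | ⟨h2, h2'⟩
        · exact Or.inl (h2.trans h1)
        · exact Or.inl (h2.trans_lt h1)
        · exact Or.inl (h2.trans_eq h1)
        · exact Or.inr ⟨h2.trans h1, h1'.trans h2'⟩ }
  capacity := L

end Outcome

end MatchingMarket

/-! Run student-proposing deferred acceptance one rejection at a time. At its end, let a university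
`u` drop its worst student and follow the resulting rejection chain; it returns if `u` gets a
replacement. No student is ever rejected by her partner in a stable matching `ν`, and this persists
along the chain of `u` if `ν` gives some student held by `u` another outcome. A rural-hospitals
count then forces the chain to return (`ListStable.returns`). So stable matchings can differ only on
students held by returning universities, at most `L` for each (`disagreement_le`).

Returning chains are rare by a switching argument. Suppose that the chain of `u` returns with `s`,
and that `x` is lonely. Exchanging `u` and `x` in the list of `s` makes the chain end with `s` at
`x` instead (`exists_switch`). In the switched profile, `x` and `s` are recognised as the only empty
university reached by the chain and its only new student (`chain_end_unique`), so the switch can be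
undone. Hence for each `u` there are at most as many pairs of a profile with returning chain and a
lonely `x` as there are profiles (`card_returns_lonely_le`). The switch keeps all favourites, so
priorities that depend on the favourites do not interfere.

The number of lonely universities has mean of order `n` and, by negative correlation, variance at
most its mean. It is therefore linear in `n` with high probability, and then few chains return
(`card_many_returning_le`). Everything is done for fixed signals and tie-breaks, which makes the
bound uniform in `D` and `D'`. -/

namespace MatchingMarket

/-! ### Sequential deferred acceptance

A state `p : Fin n → ℕ` gives the place in her list at which each student currently proposes. -/

section Sequential

variable {n m : ℕ}

/-- The students that propose to `v` in state `p`. -/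
def holders (K : ℕ) (P : Fin n → Equiv.Perm (Fin m)) (p : Fin n → ℕ) (v : Fin m) :
    Finset (Fin n) :=
  Finset.univ.filter fun s => (P s v : ℕ) = p s ∧ p s < K

theorem mem_holders {K : ℕ} {P : Fin n → Equiv.Perm (Fin m)} {p : Fin n → ℕ} {v : Fin m}
    {s : Fin n} : s ∈ holders K P p v ↔ (P s v : ℕ) = p s ∧ p s < K := by
  simp [holders]

theorem eq_of_mem_holders {K : ℕ} {P : Fin n → Equiv.Perm (Fin m)} {p : Fin n → ℕ} {v v' : Fin m}
    {s : Fin n} (h : s ∈ holders K P p v) (h' : s ∈ holders K P p v') : v = v' := by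
  rw [mem_holders] at h h'
  exact (P s).injective (Fin.ext (h.1.trans h'.1.symm))

/-- `w` is the least preferred element of `A`. -/
def IsWorst (r : Fin n → Fin n → Prop) (A : Finset (Fin n)) (w : Fin n) : Prop :=
  w ∈ A ∧ ∀ t ∈ A, t ≠ w → r t w

theorem exists_isWorst (r : Fin n → Fin n → Prop) [IsStrictTotalOrder (Fin n) r]
    {A : Finset (Fin n)} (hA : A.Nonempty) : ∃ w, IsWorst r A w := by
  have wf : WellFounded (Function.swap r) := Finite.wellFounded_of_trans_of_irrefl _
  obtain ⟨w, hw, hmin⟩ := wf.has_min (A : Set (Fin n)) hA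
  refine ⟨w, hw, fun t ht hne => ?_⟩
  by_contra h
  exact hne (Std.Trichotomous.trichotomous (r := r) t w h (hmin t ht))

/-- Student `w` moves on to the next place of her list. -/
def advance (p : Fin n → ℕ) (w : Fin n) : Fin n → ℕ := Function.update p w (p w + 1)

theorem le_advance (p : Fin n → ℕ) (w : Fin n) : p ≤ advance p w := by
  intro s
  by_cases h : s = w
  · subst h; simp [advance]
  · simp [advance, h]

open Classical in
/-- The least preferred element of `A` moves on. -/
noncomputable def rejectWorst (r : Fin n → Fin n → Prop) (A : Finset (Fin n)) (p : Fin n → ℕ) :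
    Fin n → ℕ :=
  if h : ∃ w, IsWorst r A w then advance p h.choose else p

open Classical in
/-- Some university with more than `L` proposals rejects the worst one. -/
noncomputable def step (r : Fin m → Fin n → Fin n → Prop) (L : ℕ) (H : Fin m → Finset (Fin n))
    (p : Fin n → ℕ) : Fin n → ℕ :=
  if h : ∃ v, L < (H v).card then rejectWorst (r h.choose) (H h.choose) p else p

variable (r : Fin m → Fin n → Fin n → Prop) (K L : ℕ) (P : Fin n → Equiv.Perm (Fin m))

/-- One rejection of the sequential algorithm. -/
noncomputable def rejection (p : Fin n → ℕ) : Fin n → ℕ := step r L (holders K P p) p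

/-- The sequential algorithm, started in state `p`. -/
noncomputable def run (p : Fin n → ℕ) : Fin n → ℕ := (rejection r K L P)^[n * K + 1] p

/-- The state at the end of student-proposing deferred acceptance. -/
noncomputable def finalState : Fin n → ℕ := run r K L P fun _ => 0

/-- The state after `u` has rejected its worst student at the end of deferred acceptance. -/
noncomputable def dropState (u : Fin m) : Fin n → ℕ :=
  rejectWorst (r u) (holders K P (finalState r K L P) u) (finalState r K L P)

/-- The state at the end of the rejection chain that starts when `u` rejects its worst student at
the end of deferred acceptance. -/
noncomputable def chainState (u : Fin m) : Fin n → ℕ := run r K L P (dropState r K L P u)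

/-- The rejection chain started by `u` brings `u` a new student. -/
def Returns (u : Fin m) : Prop :=
  (holders K P (finalState r K L P) u).Nonempty ∧
    (holders K P (chainState r K L P u) u).card = (holders K P (finalState r K L P) u).card

variable {r K L P}

theorem rejection_of_terminal {p : Fin n → ℕ} (h : ∀ v, (holders K P p v).card ≤ L) :
    rejection r K L P p = p := by
  rw [rejection, step, dif_neg]
  push Not
  exact h

theorem rejection_eq [∀ u, IsStrictTotalOrder (Fin n) (r u)] {p : Fin n → ℕ}
    (h : ¬ ∀ v, (holders K P p v).card ≤ L) :
    ∃ v w, L < (holders K P p v).card ∧ IsWorst (r v) (holders K P p v) w ∧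
      rejection r K L P p = advance p w := by
  push Not at h
  have h2 : ∃ w, IsWorst (r h.choose) (holders K P p h.choose) w :=
    exists_isWorst _ (Finset.card_pos.1 ((Nat.zero_le _).trans_lt h.choose_spec))
  refine ⟨h.choose, h2.choose, h.choose_spec, h2.choose_spec, ?_⟩
  rw [rejection, step, dif_pos h, rejectWorst, dif_pos h2]

/-- Terminal states are fixed by `rejection`, so an invariant has to be checked only at genuine
rejections. -/
theorem iterate_induction [∀ u, IsStrictTotalOrder (Fin n) (r u)] {Q : (Fin n → ℕ) → Prop}
    (hQ : ∀ p v w, Q p → L < (holders K P p v).card → IsWorst (r v) (holders K P p v) w →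
      Q (advance p w)) {p : Fin n → ℕ} (hp : Q p) (k : ℕ) : Q ((rejection r K L P)^[k] p) := by
  induction k with
  | zero => exact hp
  | succ k ih =>
    rw [Function.iterate_succ_apply']
    by_cases h : ∀ v, (holders K P ((rejection r K L P)^[k] p) v).card ≤ L
    · rwa [rejection_of_terminal h]
    · obtain ⟨v, w, h1, h2, h3⟩ := rejection_eq (r := r) h
      rw [h3]
      exact hQ _ v w ih h1 h2

theorem le_iterate [∀ u, IsStrictTotalOrder (Fin n) (r u)] (p : Fin n → ℕ) (k : ℕ) :
    p ≤ (rejection r K L P)^[k] p :=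
  iterate_induction (Q := fun q => p ≤ q) (fun q _ w h _ _ => h.trans (le_advance q w)) le_rfl k

theorem iterate_le_iterate [∀ u, IsStrictTotalOrder (Fin n) (r u)] (p : Fin n → ℕ) {k l : ℕ}
    (h : k ≤ l) : (rejection r K L P)^[k] p ≤ (rejection r K L P)^[l] p := by
  obtain ⟨d, rfl⟩ := Nat.exists_eq_add_of_le' h
  rw [Function.iterate_add_apply]
  exact le_iterate _ _

theorem advance_le {p : Fin n → ℕ} {v : Fin m} {w : Fin n} (h : w ∈ holders K P p v)
    (hp : ∀ s, p s ≤ K) (s : Fin n) : advance p w s ≤ K := by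
  by_cases hs : s = w
  · subst hs
    simpa [advance] using (mem_holders.1 h).2
  · simpa [advance, hs] using hp s

theorem iterate_le [∀ u, IsStrictTotalOrder (Fin n) (r u)] {p : Fin n → ℕ} (hp : ∀ s, p s ≤ K)
    (k : ℕ) : ∀ s, (rejection r K L P)^[k] p s ≤ K :=
  iterate_induction (Q := fun q => ∀ s, q s ≤ K) (fun _ _ _ hq _ hw => advance_le hw.1 hq) hp k

theorem run_terminal [∀ u, IsStrictTotalOrder (Fin n) (r u)] {p : Fin n → ℕ}
    (hp : ∀ s, p s ≤ K) (v : Fin m) : (holders K P (run r K L P p) v).card ≤ L := by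
  -- Each genuine rejection raises the sum of the places by one, and this sum never exceeds `n * K`;
  -- hence `n * K + 1` rounds suffice.
  have key : ∀ k, (∀ v, (holders K P ((rejection r K L P)^[k] p) v).card ≤ L) ∨
      k ≤ ∑ s, (rejection r K L P)^[k] p s := by
    intro k
    induction k with
    | zero => exact Or.inr (Nat.zero_le _)
    | succ k ih =>
      rw [Function.iterate_succ_apply']
      by_cases h : ∀ v, (holders K P ((rejection r K L P)^[k] p) v).card ≤ L
      · left
        rwa [rejection_of_terminal h]
      · right
        obtain ⟨v, w, -, -, h3⟩ := rejection_eq (r := r) h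
        rw [h3, advance, Finset.sum_update_of_mem (Finset.mem_univ w)]
        have h4 := ih.resolve_left h
        rw [← Finset.add_sum_erase _ _ (Finset.mem_univ w)] at h4
        rw [← Finset.erase_eq]
        omega
  refine (key (n * K + 1)).resolve_right (fun h => ?_) v
  have h2 : ∑ s, (rejection r K L P)^[n * K + 1] p s ≤ ∑ _s : Fin n, K :=
    Finset.sum_le_sum fun s _ => iterate_le hp _ s
  simp only [Finset.sum_const, Finset.card_univ, Fintype.card_fin, smul_eq_mul] at h2
  omega

theorem finalState_le [∀ u, IsStrictTotalOrder (Fin n) (r u)] (s : Fin n) :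
    finalState r K L P s ≤ K := iterate_le (fun _ => Nat.zero_le _) _ s

theorem card_finalState_le [∀ u, IsStrictTotalOrder (Fin n) (r u)] (v : Fin m) :
    (holders K P (finalState r K L P) v).card ≤ L := run_terminal (fun _ => Nat.zero_le _) v

theorem dropState_eq [∀ u, IsStrictTotalOrder (Fin n) (r u)] {u : Fin m}
    (h : (holders K P (finalState r K L P) u).Nonempty) :
    ∃ w, IsWorst (r u) (holders K P (finalState r K L P) u) w ∧
      dropState r K L P u = advance (finalState r K L P) w := by
  have h2 := exists_isWorst (r u) h
  exact ⟨h2.choose, h2.choose_spec, by rw [dropState, rejectWorst, dif_pos h2]⟩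

theorem dropState_le [∀ u, IsStrictTotalOrder (Fin n) (r u)] {u : Fin m}
    (h : (holders K P (finalState r K L P) u).Nonempty) (s : Fin n) :
    dropState r K L P u s ≤ K := by
  obtain ⟨w, hw, h2⟩ := dropState_eq h
  rw [h2]
  exact advance_le hw.1 finalState_le s

theorem card_chainState_le [∀ u, IsStrictTotalOrder (Fin n) (r u)] {u : Fin m}
    (h : (holders K P (finalState r K L P) u).Nonempty) (v : Fin m) :
    (holders K P (chainState r K L P u) v).card ≤ L := run_terminal (dropState_le h) v

/-! ### Rejection chains -/

theorem mem_holders_advance {p : Fin n → ℕ} {w s : Fin n} (hs : s ≠ w) (v : Fin m) :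
    s ∈ holders K P (advance p w) v ↔ s ∈ holders K P p v := by
  simp [mem_holders, advance, hs]

/-- The rejected student leaves `v` and joins at most one university `v'`, which is arbitrary if her
list is exhausted. Indicators on both sides avoid truncated subtraction. -/
theorem card_holders_advance {p : Fin n → ℕ} {v : Fin m} {w : Fin n} (hw : w ∈ holders K P p v) :
    ∃ v', ∀ y, (holders K P (advance p w) y).card + (if y = v then 1 else 0) ≤
      (holders K P p y).card + (if y = v' then 1 else 0) := by
  classical
  obtain ⟨v', hv'⟩ : ∃ v', ∀ y, w ∈ holders K P (advance p w) y → y = v' := by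
    by_cases h : ∃ y, w ∈ holders K P (advance p w) y
    · exact ⟨h.choose, fun y hy => eq_of_mem_holders hy h.choose_spec⟩
    · exact ⟨v, fun y hy => absurd ⟨y, hy⟩ h⟩
  refine ⟨v', fun y => ?_⟩
  have h1 : (holders K P (advance p w) y).card ≤
      ((holders K P p y).erase w).card + (if y = v' then 1 else 0) := by
    split_ifs with h
    · refine (Finset.card_le_card (t := insert w ((holders K P p y).erase w)) ?_).trans
        (Finset.card_insert_le _ _)
      intro s hs
      by_cases hsw : s = w
      · simp [hsw]
      · simp [hsw, (mem_holders_advance hsw y).1 hs]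
    · rw [add_zero]
      refine Finset.card_le_card ?_
      intro s hs
      have hsw : s ≠ w := by
        rintro rfl
        exact h (hv' y hs)
      simp [hsw, (mem_holders_advance hsw y).1 hs]
  have h2 : ((holders K P p y).erase w).card + (if y = v then 1 else 0) ≤
      (holders K P p y).card := by
    split_ifs with h
    · subst h
      rw [Finset.card_erase_add_one hw]
    · rw [add_zero]
      exact Finset.card_erase_le
  omega

/-- In the course of the chain started by `u`, the universities have as many proposals as at the
end of deferred acceptance, except that `u` may miss one and one university may have an extra one;
`u` still has its old students apart from the worst one. -/
theorem chain_invariant [∀ u, IsStrictTotalOrder (Fin n) (r u)] {u : Fin m} {w : Fin n}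
    (hw : w ∈ holders K P (finalState r K L P) u)
    (hd : dropState r K L P u = advance (finalState r K L P) w) (k : ℕ) :
    (∃ v, ∀ y, (holders K P ((rejection r K L P)^[k] (dropState r K L P u)) y).card +
        (if y = u then 1 else 0) ≤
      (holders K P (finalState r K L P) y).card + (if y = v then 1 else 0)) ∧
    (holders K P (finalState r K L P) u).erase w ⊆
      holders K P ((rejection r K L P)^[k] (dropState r K L P u)) u := by
  refine iterate_induction (Q := fun q => (∃ v, ∀ y, (holders K P q y).card +
        (if y = u then 1 else 0) ≤
      (holders K P (finalState r K L P) y).card + (if y = v then 1 else 0)) ∧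
    (holders K P (finalState r K L P) u).erase w ⊆ holders K P q u) ?_ ?_ k
  · rintro q v' w' ⟨⟨v, hv⟩, hsub⟩ hover hworst
    have h1 := hv v'
    have h2 := card_finalState_le (r := r) (K := K) (L := L) (P := P) v'
    have hvv : v' = v := by
      by_contra hne
      rw [if_neg hne] at h1
      omega
    -- At `u` the vacancy offsets any surplus, so `u` is never overfull and rejects nobody during
    -- the chain.
    have hvu : v' ≠ u := by
      intro hne
      rw [if_pos hne] at h1
      split_ifs at h1
      omega
    subst hvv
    obtain ⟨v'', h3⟩ := card_holders_advance hworst.1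
    refine ⟨⟨v'', fun y => ?_⟩, fun s hs => ?_⟩
    · have h4 := h3 y
      have h5 := hv y
      omega
    · have hsu := hsub hs
      have hne : s ≠ w' := by
        rintro rfl
        exact hvu (eq_of_mem_holders hworst.1 hsu)
      exact (mem_holders_advance hne u).2 hsu
  · rw [hd]
    refine ⟨card_holders_advance hw, fun s hs => ?_⟩
    rw [Finset.mem_erase] at hs
    exact (mem_holders_advance hs.1 u).2 hs.2

/-- The chain started by `u` ends with at most one student at a university that had no students
before. -/
theorem chain_end_unique [∀ u, IsStrictTotalOrder (Fin n) (r u)] {u x x' : Fin m} {s s' : Fin n}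
    (hu : (holders K P (finalState r K L P) u).Nonempty)
    (hx : holders K P (finalState r K L P) x = ∅) (hs : s ∈ holders K P (chainState r K L P u) x)
    (hx' : holders K P (finalState r K L P) x' = ∅)
    (hs' : s' ∈ holders K P (chainState r K L P u) x') : x = x' ∧ s = s' := by
  obtain ⟨w, hw, hd⟩ := dropState_eq hu
  obtain ⟨⟨v, hv⟩, -⟩ := chain_invariant hw.1 hd (n * K + 1)
  change ∀ y, (holders K P (chainState r K L P u) y).card + _ ≤ _ at hv
  have hxv : ∀ {y t}, holders K P (finalState r K L P) y = ∅ →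
      t ∈ holders K P (chainState r K L P u) y → y = v := by
    intro y t hy ht
    by_contra hne
    have h1 := hv y
    have h2 := Finset.card_pos.2 ⟨t, ht⟩
    rw [hy, if_neg hne, Finset.card_empty] at h1
    omega
  have h1 := hxv hx hs
  have h2 := hxv hx' hs'
  subst h1
  subst h2
  refine ⟨rfl, Finset.card_le_one.1 ?_ s hs s' hs'⟩
  have h3 := hv x'
  rw [hx, if_pos rfl, Finset.card_empty] at h3
  omega

/-! ### Switching -/

/-- Exchange `u` and `x` in the list of `s`. -/
def switch (P : Fin n → Equiv.Perm (Fin m)) (s : Fin n) (u x : Fin m) :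
    Fin n → Equiv.Perm (Fin m) := Function.update P s (P s * Equiv.swap u x)

theorem switch_of_ne {s t : Fin n} (h : t ≠ s) (u x : Fin m) : switch P s u x t = P t := by
  simp [switch, h]

theorem switch_self (s : Fin n) (u x y : Fin m) :
    switch P s u x s y = P s (Equiv.swap u x y) := by
  simp [switch]

theorem switch_injective {P' : Fin n → Equiv.Perm (Fin m)} {s : Fin n} {u x : Fin m}
    (h : switch P s u x = switch P' s u x) : P = P' := by
  funext t
  have h1 := congrFun h t
  by_cases ht : t = s
  · subst ht
    simpa [switch] using h1
  · rwa [switch_of_ne ht, switch_of_ne ht] at h1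

/-- A rejection sees the lists only through `holders`, so exchanging two universities that `s` has
not yet reached does not affect it. -/
theorem holders_switch {p : Fin n → ℕ} {s : Fin n} {u x : Fin m} (hu : p s < P s u)
    (hx : p s < P s x) : holders K (switch P s u x) p = holders K P p := by
  funext y
  ext t
  rw [mem_holders, mem_holders]
  by_cases ht : t = s
  · subst ht
    rw [switch_self]
    rcases eq_or_ne y u with rfl | hyu
    · rw [Equiv.swap_apply_left]
      omega
    rcases eq_or_ne y x with rfl | hyx
    · rw [Equiv.swap_apply_right]
      omega
    rw [Equiv.swap_apply_of_ne_of_ne hyu hyx]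
  · rw [switch_of_ne ht]

/-- The student `s` is the newcomer at `u`. The two runs coincide as long as she has not reached the
place of `u` in her list; when she does, both chains stop, one at `u` and the other at `x`. -/
theorem exists_switch [∀ u, IsStrictTotalOrder (Fin n) (r u)] {u x : Fin m}
    (hu : Returns r K L P u) (hx : ∀ s, K ≤ (P s x : ℕ)) :
    ∃ s, 0 < (P s u : ℕ) ∧ 0 < (P s x : ℕ) ∧
      (holders K (switch P s u x) (finalState r K L (switch P s u x)) u).Nonempty ∧
      holders K (switch P s u x) (finalState r K L (switch P s u x)) x = ∅ ∧
      s ∈ holders K (switch P s u x) (chainState r K L (switch P s u x) u) x := by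
  classical
  obtain ⟨hne, hcard⟩ := hu
  obtain ⟨w, hw, hd⟩ := dropState_eq hne
  have hmono : dropState r K L P u ≤ chainState r K L P u := le_iterate _ _
  have hmono0 : finalState r K L P ≤ dropState r K L P u := by
    rw [hd]; exact le_advance _ _
  have hwc : w ∉ holders K P (chainState r K L P u) u := by
    intro h
    have h1 := hmono w
    rw [hd] at h1
    have h2 := (mem_holders.1 h).1
    have h3 := (mem_holders.1 hw.1).1
    simp only [advance, Function.update_self] at h1
    omega
  -- The dropped `w` has passed `u` for good, so an unchanged number of students requires a
  -- newcomer.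
  obtain ⟨s, hs, hs0⟩ : ∃ s ∈ holders K P (chainState r K L P u) u,
      s ∉ holders K P (finalState r K L P) u := by
    by_contra! h
    have h1 : holders K P (chainState r K L P u) u ⊆
        (holders K P (finalState r K L P) u).erase w := fun t ht =>
      Finset.mem_erase.2 ⟨fun h2 => hwc (h2 ▸ ht), h t ht⟩
    have h2 := Finset.card_le_card h1
    have h3 := Finset.card_erase_add_one hw.1
    omega
  have hj := mem_holders.1 hs
  -- The newcomer reaches `u` only during the chain. In particular `u` is not her favourite, which
  -- is what preserves the priorities.
  have hlt0 : finalState r K L P s < P s u := by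
    have h1 : finalState r K L P s ≤ dropState r K L P u s := hmono0 s
    have h2 : dropState r K L P u s ≤ chainState r K L P u s := hmono s
    have h3 : (P s u : ℕ) ≠ finalState r K L P s := fun h =>
      hs0 (mem_holders.2 ⟨h, by omega⟩)
    omega
  have hKx := hx s
  set P' := switch P s u x with hP'
  -- The second alternative restricts the induction to rounds that precede the final state, where
  -- the place of `s` is bounded by its final value.
  have hiter : ∀ k, (rejection r K L P')^[k] (fun _ => 0) = (rejection r K L P)^[k] (fun _ => 0) ∨
      n * K + 1 < k := by
    intro k
    induction k with
    | zero => exact Or.inl rfl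
    | succ k ih =>
      by_cases hk : n * K + 1 < k + 1
      · exact Or.inr hk
      · left
        rw [Function.iterate_succ_apply', Function.iterate_succ_apply',
          ih.resolve_right (by omega), rejection, rejection, holders_switch]
        all_goals
          have h1 : (rejection r K L P)^[k] (fun _ => 0) s ≤ finalState r K L P s :=
            iterate_le_iterate _ (by omega) s
          omega
  have hfin : finalState r K L P' = finalState r K L P :=
    (hiter (n * K + 1)).resolve_right (by omega)
  have hhold : holders K P' (finalState r K L P) = holders K P (finalState r K L P) :=
    holders_switch hlt0 (by omega)
  have hdrop : dropState r K L P' u = dropState r K L P u := by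
    rw [dropState, dropState, hfin, hhold]
  have hchain : ∀ k, (rejection r K L P')^[k] (dropState r K L P u) =
      (rejection r K L P)^[k] (dropState r K L P u) ∨ n * K + 1 < k := by
    intro k
    induction k with
    | zero => exact Or.inl rfl
    | succ k ih =>
      by_cases hk : n * K + 1 < k + 1
      · exact Or.inr hk
      left
      rw [Function.iterate_succ_apply', Function.iterate_succ_apply',
        ih.resolve_right (by omega)]
      obtain ⟨⟨v, hv⟩, hsub⟩ := chain_invariant hw.1 hd k
      have h1 : (rejection r K L P)^[k] (dropState r K L P u) s ≤ chainState r K L P u s :=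
        iterate_le_iterate _ (by omega) s
      generalize (rejection r K L P)^[k] (dropState r K L P u) = p at *
      rcases lt_or_eq_of_le h1 with h1 | h1
      · rw [rejection, rejection, holders_switch]
        all_goals omega
      -- Here `s` has arrived. The vacancy at `u` is filled, so the surplus of the invariant sits at
      -- `u` and the state is terminal. In the switched profile `x` holds `s` alone, so the state is
      -- terminal there too.
      · have hsu : s ∈ holders K P p u := mem_holders.2 (by rw [h1]; exact hj)
        have h2 : (holders K P (finalState r K L P) u).card ≤ (holders K P p u).card := by
          have h3 : insert s ((holders K P (finalState r K L P) u).erase w) ⊆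
              holders K P p u := Finset.insert_subset hsu hsub
          have h4 := Finset.card_le_card h3
          rw [Finset.card_insert_of_notMem (by simp [hs0]), Finset.card_erase_add_one hw.1] at h4
          exact h4
        have huv : u = v := by
          by_contra hne
          have h3 := hv u
          rw [if_pos rfl, if_neg hne] at h3
          omega
        subst huv
        have hle : ∀ y, (holders K P p y).card ≤ L := fun y => by
          have h3 := hv y
          have h4 := card_finalState_le (r := r) (K := K) (L := L) (P := P) y
          omega
        have hL : 1 ≤ L := (Finset.card_pos.2 ⟨s, hsu⟩).trans_le (hle u)
        rw [rejection_of_terminal hle, rejection_of_terminal]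
        intro y
        by_cases hyx : y = x
        · refine le_trans (Finset.card_le_one.2 ?_) hL
          have h5 : ∀ t ∈ holders K P' p y, t = s := by
            intro t ht
            by_contra hts
            rw [mem_holders, hP', switch_of_ne hts, hyx] at ht
            have := hx t
            omega
          intro a ha b hb
          rw [h5 a ha, h5 b hb]
        · refine le_trans (Finset.card_le_card ?_) (hle y)
          intro t ht
          rw [mem_holders, hP'] at ht
          by_cases hts : t = s
          · subst hts
            rw [switch_self] at ht
            by_cases hyu : y = u
            · rw [hyu]; exact hsu
            · rw [Equiv.swap_apply_of_ne_of_ne hyu hyx] at ht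
              exact mem_holders.2 ht
          · rw [switch_of_ne hts] at ht
            exact mem_holders.2 ht
  have hchainState : chainState r K L P' u = chainState r K L P u := by
    rw [chainState, hdrop]
    exact (hchain (n * K + 1)).resolve_right (by omega)
  refine ⟨s, by omega, by omega, ?_, ?_, ?_⟩
  · rw [hfin, hhold]
    exact hne
  · rw [hfin, hhold, Finset.eq_empty_iff_forall_notMem]
    intro t ht
    have h1 := mem_holders.1 ht
    have := hx t
    omega
  · rw [hchainState, mem_holders, switch_self, Equiv.swap_apply_right]
    exact hj

end Sequential

/-! ### Stable matchings compared with deferred acceptance, and the counting of returning chains -/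

section Comparison

variable {n m : ℕ}

/-- The students that `ν` assigns to `v`. -/
def assigned (ν : Fin n → Option (Fin m)) (v : Fin m) : Finset (Fin n) :=
  Finset.univ.filter fun s => ν s = some v

theorem mem_assigned {ν : Fin n → Option (Fin m)} {v : Fin m} {s : Fin n} :
    s ∈ assigned ν v ↔ ν s = some v := by
  simp [assigned]

theorem ncard_eq_card_assigned (ν : Fin n → Option (Fin m)) (v : Fin m) :
    {s | ν s = some v}.ncard = (assigned ν v).card := by
  rw [← Set.ncard_coe_finset]
  congr 1
  ext s
  simp [mem_assigned]

/-- Stability of `ν` in terms of the places in the lists of the students. -/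
structure ListStable (r : Fin m → Fin n → Fin n → Prop) (K L : ℕ) (P : Fin n → Equiv.Perm (Fin m))
    (ν : Fin n → Option (Fin m)) : Prop where
  card_le : ∀ v, (assigned ν v).card ≤ L
  lt : ∀ s v, ν s = some v → (P s v : ℕ) < K
  full : ∀ s u, (P s u : ℕ) < K → (∀ v, ν s = some v → (P s u : ℕ) < P s v) →
    (assigned ν u).card = L ∧ ∀ t, ν t = some u → ¬ r u s t

theorem listStable_of_isStable {ω : Outcome n m} {K L : ℕ} {ν : Fin n → Option (Fin m)}
    (h : (ω.market K L).IsStable ν) : ListStable ω.Ranks K L ω.1 ν := by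
  obtain ⟨h1, h2, h3⟩ := h
  have hlt : ∀ s v, ν s = some v → (ω.1 s v : ℕ) < K := by
    intro s v hv
    have h4 := h2 s
    rw [hv] at h4
    simp only [Outcome.market, Outcome.place] at h4
    split_ifs at h4 <;> omega
  refine ⟨fun v => ?_, hlt, fun s u hu hpref => ?_⟩
  · rw [← ncard_eq_card_assigned]
    exact h1 v
  · have h4 : (ω.market K L).studentPrefers s (some u) (ν s) := by
      rcases hs : ν s with _ | v
      · simp only [Outcome.market, Outcome.place, if_pos hu]
        exact hu
      · have h5 := hpref v hs
        have h6 := hlt s v hs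
        simp only [Outcome.market, Outcome.place, if_pos hu, if_pos h6]
        exact h5
    have h5 := h3 s u
    simp only [Market.Blocks, not_and, not_or] at h5
    obtain ⟨h6, h7⟩ := h5 h4
    refine ⟨le_antisymm ?_ ?_, fun t ht hr => h7 ⟨t, ht, hr⟩⟩
    · rw [← ncard_eq_card_assigned]
      exact h1 u
    · rw [← ncard_eq_card_assigned]
      exact not_lt.1 h6

variable {r : Fin m → Fin n → Fin n → Prop} {K L : ℕ} {P : Fin n → Equiv.Perm (Fin m)}
  {ν : Fin n → Option (Fin m)}

/-- In state `p` no student has been rejected by her partner in `ν`. -/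
def NotBeyond (P : Fin n → Equiv.Perm (Fin m)) (ν : Fin n → Option (Fin m)) (p : Fin n → ℕ) :
    Prop := ∀ s v, ν s = some v → p s ≤ P s v

/-- Since `s` has not passed her partner in `ν`, proposing to a different `u` means that she prefers
`u`; stability does the rest. -/
theorem ListStable.full_of_mem_holders (hν : ListStable r K L P ν) {p : Fin n → ℕ}
    (hp : NotBeyond P ν p) {s : Fin n} {u : Fin m} (hs : s ∈ holders K P p u)
    (hne : ν s ≠ some u) :
    (assigned ν u).card = L ∧ ∀ t, ν t = some u → ¬ r u s t := by
  rw [mem_holders] at hs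
  refine hν.full s u (by omega) fun v hv => ?_
  have h1 := hp s v hv
  refine lt_of_le_of_ne (by omega) fun h => hne ?_
  rw [hv, (P s).injective (Fin.ext h)]

theorem NotBeyond.advance {p : Fin n → ℕ} (hp : NotBeyond P ν p) {v : Fin m} {w : Fin n}
    (hw : w ∈ holders K P p v) (hne : ν w ≠ some v) :
    NotBeyond P ν (MatchingMarket.advance p w) := by
  intro s y hy
  by_cases hs : s = w
  · subst hs
    rw [mem_holders] at hw
    have h1 := hp s y hy
    have h2 : (P s y : ℕ) ≠ P s v := by
      intro h
      rw [(P s).injective (Fin.ext h)] at hy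
      exact hne hy
    simp only [MatchingMarket.advance, Function.update_self]
    omega
  · simpa [MatchingMarket.advance, hs] using hp s y hy

/-- If `ν` placed the worst proposer at `v`, then `t`, whom `v` ranks higher, would block `ν`
together with `v`. -/
theorem ListStable.ne_of_isWorst [∀ u, IsStrictTotalOrder (Fin n) (r u)]
    (hν : ListStable r K L P ν) {p : Fin n → ℕ} (hp : NotBeyond P ν p) {v : Fin m} {w t : Fin n}
    (hw : IsWorst (r v) (holders K P p v) w) (ht : t ∈ holders K P p v) (htν : ν t ≠ some v) :
    ν w ≠ some v := by
  intro hwν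
  have htw : t ≠ w := fun h => htν (h ▸ hwν)
  exact (hν.full_of_mem_holders hp ht htν).2 w hwν (hw.2 t ht htw)

/-- This is the student-optimality argument: an overfull university holds someone whom `ν` does not
place there, so by `ListStable.ne_of_isWorst` it does not reject a `ν`-partner. Any starting state
is allowed, so it also applies to chains. -/
theorem ListStable.notBeyond_iterate [∀ u, IsStrictTotalOrder (Fin n) (r u)]
    (hν : ListStable r K L P ν) {p : Fin n → ℕ} (hp : NotBeyond P ν p) (k : ℕ) :
    NotBeyond P ν ((rejection r K L P)^[k] p) := by
  refine iterate_induction (fun q v w hq hover hw => ?_) hp k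
  obtain ⟨t, ht, htν⟩ : ∃ t ∈ holders K P q v, ν t ≠ some v := by
    by_contra! h
    have h1 : holders K P q v ⊆ assigned ν v := fun t ht => mem_assigned.2 (h t ht)
    have h2 := Finset.card_le_card h1
    have h3 := hν.card_le v
    omega
  exact hq.advance hw.1 (hν.ne_of_isWorst hq hw ht htν)

/-- The universities have as many students in `ν` as in a final state that is at least as good for
the students. -/
theorem ListStable.card_assigned_eq (hν : ListStable r K L P ν) {p : Fin n → ℕ}
    (hp : NotBeyond P ν p) (hL : ∀ v, (holders K P p v).card ≤ L) (v : Fin m) :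
    (holders K P p v).card = (assigned ν v).card := by
  classical
  -- Rural hospitals: university by university `ν` has at least as many students, because a holder
  -- not placed there by `ν` forces `ν` to fill all `L` seats. In total it has at most as many,
  -- because every student matched by `ν` still proposes in `p`.
  have hle : ∀ v ∈ (Finset.univ : Finset (Fin m)),
      (holders K P p v).card ≤ (assigned ν v).card := by
    intro v _
    by_cases h : holders K P p v ⊆ assigned ν v
    · exact Finset.card_le_card h
    · obtain ⟨t, ht, htν⟩ := Finset.not_subset.1 h
      rw [(hν.full_of_mem_holders hp ht fun h => htν (mem_assigned.2 h)).1]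
      exact hL v
  have hsum : ∑ v, (assigned ν v).card ≤ ∑ v, (holders K P p v).card := by
    rw [← Finset.card_biUnion, ← Finset.card_biUnion]
    · refine Finset.card_le_card fun s hs => ?_
      simp only [Finset.mem_biUnion, Finset.mem_univ, true_and] at hs ⊢
      obtain ⟨v, hv⟩ := hs
      rw [mem_assigned] at hv
      have h1 := hp s v hv
      have h2 := hν.lt s v hv
      refine ⟨(P s).symm ⟨p s, by omega⟩, mem_holders.2 ⟨?_, by omega⟩⟩
      simp
    · intro a _ b _ hab
      refine Finset.disjoint_left.2 fun s ha hb => hab (eq_of_mem_holders ha hb)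
    · intro a _ b _ hab
      refine Finset.disjoint_left.2 fun s ha hb => hab ?_
      rw [mem_assigned] at ha hb
      exact Option.some_injective _ (ha.symm.trans hb)
  exact (Finset.sum_eq_sum_iff_of_le hle).1
    (le_antisymm (Finset.sum_le_sum hle) hsum) v (Finset.mem_univ v)

/-- The worst student at `u` is not a `ν`-partner of `u` either, so dropping her passes nobody's
partner. The rural-hospitals count thus applies both before and after the chain and gives `u` equal
numbers. -/
theorem ListStable.returns [∀ u, IsStrictTotalOrder (Fin n) (r u)] (hν : ListStable r K L P ν)
    {s : Fin n} {u : Fin m} (hs : s ∈ holders K P (finalState r K L P) u) (hne : ν s ≠ some u) :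
    Returns r K L P u := by
  have h0 : NotBeyond P ν (finalState r K L P) :=
    hν.notBeyond_iterate (fun _ _ _ => Nat.zero_le _) _
  obtain ⟨w, hw, hd⟩ := dropState_eq ⟨s, hs⟩
  have h1 : NotBeyond P ν (chainState r K L P u) := by
    refine hν.notBeyond_iterate ?_ _
    rw [hd]
    exact h0.advance hw.1 (hν.ne_of_isWorst h0 hw hs hne)
  refine ⟨⟨s, hs⟩, ?_⟩
  rw [hν.card_assigned_eq h0 card_finalState_le, hν.card_assigned_eq h1 (card_chainState_le ⟨s, hs⟩)]

variable (r K L P) in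
open Classical in
/-- The universities whose rejection chain returns. -/
noncomputable def returning : Finset (Fin m) := Finset.univ.filter fun u => Returns r K L P u

theorem ListStable.eq_some_iff_mem_holders [∀ u, IsStrictTotalOrder (Fin n) (r u)]
    (hν : ListStable r K L P ν) {s : Fin n}
    (h : ∀ u, s ∈ holders K P (finalState r K L P) u → u ∉ returning r K L P) (u : Fin m) :
    ν s = some u ↔ s ∈ holders K P (finalState r K L P) u := by
  have h1 : ∀ u, s ∈ holders K P (finalState r K L P) u → ν s = some u := by
    intro u hu
    by_contra hne
    exact h u hu (by simpa [returning] using hν.returns hu hne)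
  refine ⟨fun hu => ?_, h1 u⟩
  have h0 : NotBeyond P ν (finalState r K L P) :=
    hν.notBeyond_iterate (fun _ _ _ => Nat.zero_le _) _
  have h2 := h0 s u hu
  have h3 := hν.lt s u hu
  have h4 : s ∈ holders K P (finalState r K L P) ((P s).symm ⟨finalState r K L P s, by omega⟩) :=
    mem_holders.2 ⟨by simp, by omega⟩
  have h5 := h1 _ h4
  rw [hu] at h5
  rwa [← Option.some_injective _ h5] at h4

theorem disagreement_le [∀ u, IsStrictTotalOrder (Fin n) (r u)] {μ : Fin n → Option (Fin m)}
    (hμ : ListStable r K L P μ) (hν : ListStable r K L P ν) :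
    disagreement μ ν ≤ L * (returning r K L P).card := by
  classical
  have h1 : {s | μ s ≠ ν s} ⊆
      ((returning r K L P).biUnion (holders K P (finalState r K L P)) : Set (Fin n)) := by
    intro s hs
    by_contra h
    simp only [Finset.coe_biUnion, Set.mem_iUnion, not_exists, Finset.mem_coe] at h
    have h2 : ∀ u, s ∈ holders K P (finalState r K L P) u → u ∉ returning r K L P :=
      fun u hu hu' => h u hu' hu
    refine hs (Option.ext fun u => ?_)
    rw [hμ.eq_some_iff_mem_holders h2, hν.eq_some_iff_mem_holders h2]
  refine (Set.ncard_le_ncard h1 (Finset.finite_toSet _)).trans ?_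
  rw [Set.ncard_coe_finset, mul_comm]
  exact Finset.card_biUnion_le_card_mul _ _ _ fun u _ => card_finalState_le u

/-! ### Counting -/

/-- The universities that are among the first `K` of no student. -/
def lonely (K : ℕ) (P : Fin n → Equiv.Perm (Fin m)) : Finset (Fin m) :=
  Finset.univ.filter fun x => ∀ s, K ≤ (P s x : ℕ)

open Classical in
/-- For a fixed university, returning chains are rare among the profiles with many lonely
universities. The priorities may depend on the profile through the favourites. -/
theorem card_returns_lonely_le {R : (Fin n → Equiv.Perm (Fin m)) → Fin m → Fin n → Fin n → Prop}
    [∀ P u, IsStrictTotalOrder (Fin n) (R P u)]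
    (hR : ∀ P s u x, 0 < (P s u : ℕ) → 0 < (P s x : ℕ) → R (switch P s u x) = R P) (u : Fin m) :
    (Finset.univ.filter fun z : (Fin n → Equiv.Perm (Fin m)) × Fin m =>
      Returns (R z.1) K L z.1 u ∧ z.2 ∈ lonely K z.1).card ≤
      Fintype.card (Fin n → Equiv.Perm (Fin m)) := by
  rcases isEmpty_or_nonempty (Fin n) with hn | hn
  · rw [Finset.filter_false_of_mem]
    · simp
    · rintro z - ⟨⟨⟨s, -⟩, -⟩, -⟩
      exact hn.elim s
  have key : ∀ z : (Fin n → Equiv.Perm (Fin m)) × Fin m, ∃ s,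
      (Returns (R z.1) K L z.1 u ∧ z.2 ∈ lonely K z.1) →
      0 < (z.1 s u : ℕ) ∧ 0 < (z.1 s z.2 : ℕ) ∧
      (holders K (switch z.1 s u z.2) (finalState (R z.1) K L (switch z.1 s u z.2)) u).Nonempty ∧
      holders K (switch z.1 s u z.2) (finalState (R z.1) K L (switch z.1 s u z.2)) z.2 = ∅ ∧
      s ∈ holders K (switch z.1 s u z.2) (chainState (R z.1) K L (switch z.1 s u z.2) u) z.2 := by
    intro z
    by_cases h : Returns (R z.1) K L z.1 u ∧ z.2 ∈ lonely K z.1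
    · obtain ⟨s, hs⟩ := exists_switch (x := z.2) h.1 (by simpa [lonely] using h.2)
      exact ⟨s, fun _ => hs⟩
    · exact ⟨hn.some, fun h' => absurd h' h⟩
  choose f hf using key
  -- Injectivity: `hR` turns the priorities into those of the switched profile, so that profile
  -- alone determines the chain, hence its end `(s, x)`, and finally the original lists.
  refine Finset.card_le_card_of_injOn (fun z => switch z.1 (f z) u z.2)
    (fun _ _ => Finset.mem_univ _) ?_
  rintro z hz z' hz' heq
  simp only [Finset.coe_filter, Finset.mem_univ, true_and, Set.mem_ofPred_eq] at hz hz'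
  obtain ⟨a1, a2, a3, a4, a5⟩ := hf z hz
  obtain ⟨b1, b2, b3, b4, b5⟩ := hf z' hz'
  rw [← hR z.1 (f z) u z.2 a1 a2] at a3 a4 a5
  rw [← hR z'.1 (f z') u z'.2 b1 b2] at b3 b4 b5
  dsimp only at heq
  rw [← heq] at b3 b4 b5
  obtain ⟨h1, h2⟩ := chain_end_unique a3 a4 a5 b4 b5
  rw [← h1, ← h2] at heq
  exact Prod.ext (switch_injective heq) h1

open Classical in
theorem sum_card_lonely_mul_card_returning_le
    {R : (Fin n → Equiv.Perm (Fin m)) → Fin m → Fin n → Fin n → Prop}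
    [∀ P u, IsStrictTotalOrder (Fin n) (R P u)]
    (hR : ∀ P s u x, 0 < (P s u : ℕ) → 0 < (P s x : ℕ) → R (switch P s u x) = R P) :
    ∑ P, (lonely K P).card * (returning (R P) K L P).card ≤
      m * Fintype.card (Fin n → Equiv.Perm (Fin m)) := by
  have h1 : ∀ P : Fin n → Equiv.Perm (Fin m),
      (lonely K P).card * (returning (R P) K L P).card =
      ∑ u, ∑ x, if Returns (R P) K L P u ∧ x ∈ lonely K P then 1 else 0 := by
    intro P
    rw [mul_comm, returning, Finset.card_filter, Finset.sum_mul]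
    refine Finset.sum_congr rfl fun u _ => ?_
    by_cases h : Returns (R P) K L P u <;> simp [h]
  simp only [h1]
  rw [Finset.sum_comm]
  refine (Finset.sum_le_card_nsmul Finset.univ _
    (Fintype.card (Fin n → Equiv.Perm (Fin m))) fun u _ => ?_).trans_eq (by simp)
  rw [← Fintype.sum_prod_type', ← Finset.card_filter]
  exact card_returns_lonely_le hR u

end Comparison

/-! ### The number of lonely universities -/

section Lonely

variable {m : ℕ} (K : ℕ)

/-- The lists in which `x` is not among the first `K`. -/
def avoiding (x : Fin m) : Finset (Equiv.Perm (Fin m)) :=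
  Finset.univ.filter fun σ => K ≤ (σ x : ℕ)

/-- Relabelling the universities is a bijection of the lists, so the count depends only on whether
`x = y`. -/
theorem card_avoiding_inter_congr {x y x' y' : Fin m} (τ : Equiv.Perm (Fin m)) (hx : τ x = x')
    (hy : τ y = y') :
    (avoiding K x ∩ avoiding K y).card = (avoiding K x' ∩ avoiding K y').card := by
  refine Finset.card_bij (fun σ _ => σ * τ⁻¹) ?_ ?_ ?_
  · intro σ hσ
    subst hx hy
    simpa [avoiding] using hσ
  · intro σ _ σ' _ h
    exact mul_right_cancel h
  · intro σ hσ
    refine ⟨σ * τ, ?_, by simp⟩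
    subst hx hy
    simpa [avoiding] using hσ

theorem card_late (σ : Equiv.Perm (Fin m)) :
    (Finset.univ.filter fun x => K ≤ (σ x : ℕ)).card = m - K := by
  rw [← Finset.card_map σ.toEmbedding, Finset.map_filter']
  have h : (Finset.univ.filter fun y : Fin m => K ≤ (y : ℕ)).card = m - K := by
    have h1 := Fin.card_filter_val_lt (n := m) (m := K)
    have h2 := Finset.card_filter_add_card_filter_not (s := (Finset.univ : Finset (Fin m)))
      (p := fun y : Fin m => (y : ℕ) < K)
    simp only [not_lt, Finset.card_univ, Fintype.card_fin] at h2
    omega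
  rw [← h]
  congr 1
  ext y
  simp only [Finset.mem_filter, Finset.mem_univ, true_and, Finset.map_univ_equiv]
  constructor
  · rintro ⟨a, h1, rfl⟩
    exact h1
  · intro h1
    exact ⟨σ.symm y, by simpa using h1, by simp⟩

theorem card_avoiding (x : Fin m) : m * (avoiding K x).card = m.factorial * (m - K) := by
  have h1 : ∑ y : Fin m, (avoiding K y).card = m.factorial * (m - K) := by
    simp only [avoiding, Finset.card_filter]
    rw [Finset.sum_comm]
    simp only [← Finset.card_filter, card_late]
    simp [Fintype.card_perm]
  rw [← h1, Finset.sum_congr rfl (g := fun _ => (avoiding K x).card)]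
  · simp
  · intro y _
    have := card_avoiding_inter_congr K (x := y) (y := y) (x' := x) (y' := x) (Equiv.swap y x)
      (by simp) (by simp)
    simpa using this

/-- Double counting: each list that avoids `x` has `m - K - 1` other universities beyond its first
`K`, and by symmetry all `z ≠ x` contribute equally. -/
theorem card_avoiding_inter {x y : Fin m} (hxy : y ≠ x) :
    (m - 1) * (avoiding K x ∩ avoiding K y).card = (avoiding K x).card * (m - K - 1) := by
  have h1 : ∑ z ∈ Finset.univ.erase x, (avoiding K x ∩ avoiding K z).card =
      (avoiding K x).card * (m - K - 1) := by
    have h2 : ∀ z, (avoiding K x ∩ avoiding K z).card =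
        ∑ σ ∈ avoiding K x, if K ≤ (σ z : ℕ) then 1 else 0 := by
      intro z
      rw [← Finset.card_filter]
      congr 1
      ext σ
      simp [avoiding]
    simp only [h2]
    rw [Finset.sum_comm, Finset.card_eq_sum_ones, Finset.sum_mul]
    refine Finset.sum_congr rfl fun σ hσ => ?_
    rw [← Finset.card_filter, Finset.filter_erase, Finset.card_erase_of_mem, card_late, one_mul]
    simpa [avoiding] using hσ
  rw [← h1, Finset.sum_congr rfl (g := fun _ => (avoiding K x ∩ avoiding K y).card)]
  · simp [Finset.card_erase_of_mem]
  · intro z hz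
    exact card_avoiding_inter_congr K (Equiv.swap z y)
      (Equiv.swap_apply_of_ne_of_ne (Finset.ne_of_mem_erase hz).symm hxy.symm) (by simp)

/-- Negative correlation within one list, from `(m-K-1)/(m-1) ≤ (m-K)/m`. -/
theorem card_avoiding_inter_mul_le (hK : K ≤ m) {x y : Fin m} (hxy : y ≠ x) :
    (avoiding K x ∩ avoiding K y).card * m.factorial ≤ (avoiding K x).card ^ 2 := by
  have h1 := card_avoiding K x
  have h2 := card_avoiding_inter K hxy
  have hm : 2 ≤ m := by
    have h3 := x.isLt
    have h4 := y.isLt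
    have h5 : (y : ℕ) ≠ x := fun h => hxy (Fin.ext h)
    omega
  set A := (avoiding K x).card
  set B := (avoiding K x ∩ avoiding K y).card
  have h3 : (m - K - 1) * m ≤ (m - K) * (m - 1) := by
    obtain ⟨d, rfl⟩ := Nat.exists_eq_add_of_le hK
    rcases d with _ | d
    · simp
    · have e1 : K + (d + 1) - K - 1 = d := by omega
      have e2 : K + (d + 1) - K = d + 1 := by omega
      have e3 : K + (d + 1) - 1 = K + d := by omega
      rw [e1, e2, e3]
      nlinarith
  have hpos : 0 < m * (m - 1) := Nat.mul_pos (by omega) (by omega)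
  refine Nat.le_of_mul_le_mul_left ?_ hpos
  calc m * (m - 1) * (B * m.factorial) = m * m.factorial * ((m - 1) * B) := by ring
    _ = A * m.factorial * ((m - K - 1) * m) := by rw [h2]; ring
    _ ≤ A * m.factorial * ((m - K) * (m - 1)) := Nat.mul_le_mul_left _ h3
    _ = A * (m - 1) * (m.factorial * (m - K)) := by ring
    _ = m * (m - 1) * A ^ 2 := by rw [← h1]; ring

variable {n : ℕ}

/-- Independence of the students: the condition is imposed on each list separately. -/
theorem card_filter_lonely (x y : Fin m) :
    (Finset.univ.filter fun P : Fin n → Equiv.Perm (Fin m) =>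
      x ∈ lonely K P ∧ y ∈ lonely K P).card = (avoiding K x ∩ avoiding K y).card ^ n := by
  rw [← Fintype.card_piFinset_const]
  congr 1
  ext P
  simp [lonely, avoiding, forall_and]

/-- The probability that a given university is lonely. -/
noncomputable def lonelyProb (K m n : ℕ) : ℝ := (1 - (K : ℝ) / m) ^ n

theorem card_avoiding_div (hK : K ≤ m) (x : Fin m) :
    ((avoiding K x).card : ℝ) = m.factorial * (1 - (K : ℝ) / m) := by
  have h1 := card_avoiding K x
  have hm : (m : ℝ) ≠ 0 := by
    have := x.pos
    positivity
  have h2 : (m : ℝ) * (avoiding K x).card = m.factorial * ((m : ℝ) - K) := by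
    rw [← Nat.cast_sub hK]
    exact_mod_cast h1
  field_simp
  linarith

theorem card_profiles :
    (Fintype.card (Fin n → Equiv.Perm (Fin m)) : ℝ) = (m.factorial : ℝ) ^ n := by
  simp [Fintype.card_perm]

theorem card_lonely_self (hK : K ≤ m) (x : Fin m) :
    ((Finset.univ.filter fun P : Fin n → Equiv.Perm (Fin m) => x ∈ lonely K P).card : ℝ) =
      Fintype.card (Fin n → Equiv.Perm (Fin m)) * lonelyProb K m n := by
  have h1 := card_filter_lonely K (n := n) x x
  simp only [and_self, Finset.inter_self] at h1
  rw [h1, Nat.cast_pow, card_avoiding_div K hK, card_profiles, lonelyProb, mul_pow]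

theorem card_lonely_pair_le (hK : K ≤ m) {x y : Fin m} (hxy : y ≠ x) :
    ((Finset.univ.filter fun P : Fin n → Equiv.Perm (Fin m) =>
      x ∈ lonely K P ∧ y ∈ lonely K P).card : ℝ) ≤
      Fintype.card (Fin n → Equiv.Perm (Fin m)) * lonelyProb K m n ^ 2 := by
  rw [card_filter_lonely, card_profiles, lonelyProb, Nat.cast_pow, ← pow_mul, mul_comm n 2, pow_mul,
    ← mul_pow]
  refine pow_le_pow_left₀ (Nat.cast_nonneg _) ?_ n
  have h1 : ((avoiding K x ∩ avoiding K y).card : ℝ) * m.factorial ≤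
      ((avoiding K x).card : ℝ) ^ 2 := by
    exact_mod_cast card_avoiding_inter_mul_le K hK hxy
  rw [card_avoiding_div K hK] at h1
  have h2 : (0 : ℝ) < m.factorial := by exact_mod_cast m.factorial_pos
  refine le_of_mul_le_mul_right (h1.trans_eq ?_) h2
  ring

theorem sum_card_lonely (hK : K ≤ m) :
    ∑ P : Fin n → Equiv.Perm (Fin m), ((lonely K P).card : ℝ) =
      m * (Fintype.card (Fin n → Equiv.Perm (Fin m)) * lonelyProb K m n) := by
  have h1 : ∀ P : Fin n → Equiv.Perm (Fin m), ((lonely K P).card : ℝ) =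
      ∑ x, if x ∈ lonely K P then 1 else 0 := by
    intro P
    simp
  simp only [h1]
  rw [Finset.sum_comm]
  have h2 : ∀ x : Fin m, (∑ P : Fin n → Equiv.Perm (Fin m),
      if x ∈ lonely K P then (1 : ℝ) else 0) =
      Fintype.card (Fin n → Equiv.Perm (Fin m)) * lonelyProb K m n := by
    intro x
    rw [← card_lonely_self K hK x, Finset.card_filter]
    push_cast
    rfl
  rw [Finset.sum_congr rfl fun x _ => h2 x]
  simp

/-- The first term is the diagonal; the second bounds the pairs of distinct universities by negative
correlation. -/
theorem sum_card_lonely_sq_le (hK : K ≤ m) :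
    ∑ P : Fin n → Equiv.Perm (Fin m), ((lonely K P).card : ℝ) ^ 2 ≤
      m * (Fintype.card (Fin n → Equiv.Perm (Fin m)) * lonelyProb K m n) +
      m ^ 2 * (Fintype.card (Fin n → Equiv.Perm (Fin m)) * lonelyProb K m n ^ 2) := by
  have h1 : ∀ P : Fin n → Equiv.Perm (Fin m), ((lonely K P).card : ℝ) ^ 2 =
      ∑ x, ∑ y, if x ∈ lonely K P ∧ y ∈ lonely K P then 1 else 0 := by
    intro P
    have h2 : ((lonely K P).card : ℝ) = ∑ x, if x ∈ lonely K P then 1 else 0 := by simp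
    rw [sq, h2, Finset.sum_mul_sum]
    refine Finset.sum_congr rfl fun x _ => Finset.sum_congr rfl fun y _ => ?_
    by_cases hx : x ∈ lonely K P <;> by_cases hy : y ∈ lonely K P <;> simp [hx, hy]
  simp only [h1]
  rw [Finset.sum_comm]
  have h2 : ∀ x y : Fin m, (∑ P : Fin n → Equiv.Perm (Fin m),
      if x ∈ lonely K P ∧ y ∈ lonely K P then (1 : ℝ) else 0) ≤
      (if x = y then Fintype.card (Fin n → Equiv.Perm (Fin m)) * lonelyProb K m n else 0) +
      Fintype.card (Fin n → Equiv.Perm (Fin m)) * lonelyProb K m n ^ 2 := by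
    intro x y
    have h3 : (∑ P : Fin n → Equiv.Perm (Fin m),
        if x ∈ lonely K P ∧ y ∈ lonely K P then (1 : ℝ) else 0) =
        ((Finset.univ.filter fun P : Fin n → Equiv.Perm (Fin m) =>
          x ∈ lonely K P ∧ y ∈ lonely K P).card : ℝ) := by
      rw [Finset.card_filter]
      push_cast
      rfl
    rw [h3]
    split_ifs with hxy
    · subst hxy
      simp only [and_self]
      rw [card_lonely_self K hK]
      have : (0 : ℝ) ≤ Fintype.card (Fin n → Equiv.Perm (Fin m)) * lonelyProb K m n ^ 2 := by
        positivity
      linarith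
    · rw [zero_add]
      exact card_lonely_pair_le K hK (Ne.symm hxy)
  calc _ = ∑ x : Fin m, ∑ y : Fin m, ∑ P : Fin n → Equiv.Perm (Fin m),
        (if x ∈ lonely K P ∧ y ∈ lonely K P then (1 : ℝ) else 0) :=
        Finset.sum_congr rfl fun x _ => Finset.sum_comm
    _ ≤ ∑ x : Fin m, ∑ y : Fin m,
        ((if x = y then Fintype.card (Fin n → Equiv.Perm (Fin m)) * lonelyProb K m n else 0) +
        Fintype.card (Fin n → Equiv.Perm (Fin m)) * lonelyProb K m n ^ 2) :=
        Finset.sum_le_sum fun x _ => Finset.sum_le_sum fun y _ => h2 x y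
    _ = _ := by
        simp only [Finset.sum_add_distrib, Finset.sum_ite_eq, Finset.mem_univ, if_true,
          Finset.sum_const, Finset.card_univ, Fintype.card_fin, nsmul_eq_mul]
        ring

theorem sum_sq_card_lonely_sub_le (hK : K ≤ m) :
    ∑ P : Fin n → Equiv.Perm (Fin m), ((lonely K P).card - m * lonelyProb K m n) ^ 2 ≤
      m * (Fintype.card (Fin n → Equiv.Perm (Fin m)) * lonelyProb K m n) := by
  have h1 := sum_card_lonely K (n := n) hK
  have h2 := sum_card_lonely_sq_le K (n := n) hK
  simp only [sub_sq, Finset.sum_add_distrib, Finset.sum_sub_distrib, ← Finset.sum_mul,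
    ← Finset.mul_sum, h1, Finset.sum_const, Finset.card_univ, nsmul_eq_mul]
  linarith

/-- Chebyshev's inequality for the number of lonely universities. -/
theorem card_few_lonely_le (hK : K ≤ m) (hpos : 0 < m * lonelyProb K m n) :
    ((Finset.univ.filter fun P : Fin n → Equiv.Perm (Fin m) =>
      ((lonely K P).card : ℝ) < m * lonelyProb K m n / 2).card : ℝ) ≤
      Fintype.card (Fin n → Equiv.Perm (Fin m)) * (4 / (m * lonelyProb K m n)) := by
  have h1 := sum_sq_card_lonely_sub_le K (n := n) hK
  set a := m * lonelyProb K m n with ha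
  set S := Finset.univ.filter fun P : Fin n → Equiv.Perm (Fin m) =>
      ((lonely K P).card : ℝ) < a / 2
  -- Each profile in `S` deviates from the mean `a` by more than `a / 2`.
  have h2 : (S.card : ℝ) * (a / 2) ^ 2 ≤
      ∑ P : Fin n → Equiv.Perm (Fin m), ((lonely K P).card - a) ^ 2 := by
    rw [← nsmul_eq_mul]
    refine (Finset.card_nsmul_le_sum S _ _ fun P hP => ?_).trans
      (Finset.sum_le_univ_sum_of_nonneg fun P => sq_nonneg _)
    have h3 := (Finset.mem_filter.1 hP).2
    nlinarith
  have h3 : (S.card : ℝ) * (a / 2) ^ 2 ≤ Fintype.card (Fin n → Equiv.Perm (Fin m)) * a := by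
    refine (h2.trans h1).trans_eq ?_
    rw [ha]
    ring
  rw [mul_div_assoc', le_div_iff₀ hpos]
  refine le_of_mul_le_mul_right ?_ hpos
  nlinarith

open Classical in
/-- It is unlikely that many rejection chains return. -/
theorem card_many_returning_le {L : ℕ} (hK : K ≤ m) (hpos : 0 < m * lonelyProb K m n)
    {R : (Fin n → Equiv.Perm (Fin m)) → Fin m → Fin n → Fin n → Prop}
    [∀ P u, IsStrictTotalOrder (Fin n) (R P u)]
    (hR : ∀ P s u x, 0 < (P s u : ℕ) → 0 < (P s x : ℕ) → R (switch P s u x) = R P)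
    {t : ℝ} (ht : 0 < t) :
    ((Finset.univ.filter fun P : Fin n → Equiv.Perm (Fin m) =>
      t < (returning (R P) K L P).card).card : ℝ) ≤
      Fintype.card (Fin n → Equiv.Perm (Fin m)) *
        (4 / (m * lonelyProb K m n) + 2 / (t * lonelyProb K m n)) := by
  have h1 := card_few_lonely_le K (n := n) hK hpos
  have hm : (0 : ℝ) < m := by
    rcases Nat.eq_zero_or_pos m with h | h
    · subst h
      simp at hpos
    · exact_mod_cast h
  have hb : 0 < lonelyProb K m n := by
    rw [mul_pos_iff_of_pos_left hm] at hpos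
    exact hpos
  set b := lonelyProb K m n
  set N := Fintype.card (Fin n → Equiv.Perm (Fin m))
  set S := Finset.univ.filter fun P : Fin n → Equiv.Perm (Fin m) =>
      ((lonely K P).card : ℝ) < m * b / 2
  set T := Finset.univ.filter fun P : Fin n → Equiv.Perm (Fin m) =>
      t < (returning (R P) K L P).card
  have h2 : ((T \ S).card : ℝ) * (m * b / 2 * t) ≤ m * N := by
    -- Markov's inequality for the product: on `T \ S` it is at least `(m * b / 2) * t`.
    have h3 : (∑ P, ((lonely K P).card : ℝ) * ((returning (R P) K L P).card : ℝ)) ≤ m * N := by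
      exact_mod_cast sum_card_lonely_mul_card_returning_le (K := K) (L := L) hR
    refine le_trans ?_ h3
    rw [← nsmul_eq_mul]
    refine (Finset.card_nsmul_le_sum (T \ S)
      (fun P => ((lonely K P).card : ℝ) * ((returning (R P) K L P).card : ℝ)) _
      fun P hP => ?_).trans (Finset.sum_le_univ_sum_of_nonneg fun P => by positivity)
    simp only [T, S, Finset.mem_sdiff, Finset.mem_filter, Finset.mem_univ, true_and,
      not_lt] at hP
    exact mul_le_mul hP.2 hP.1.le ht.le (Nat.cast_nonneg _)
  have h3 : ((T \ S).card : ℝ) ≤ N * (2 / (t * b)) := by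
    rw [mul_div_assoc', le_div_iff₀ (by positivity)]
    refine le_of_mul_le_mul_left ?_ hm
    linarith
  have h4 : (T.card : ℝ) ≤ S.card + (T \ S).card := by
    exact_mod_cast (Finset.card_le_card (t := S ∪ (T \ S))
      (by simp)).trans (Finset.card_union_le _ _)
  rw [mul_add]
  linarith

end Lonely

/-! ### Deferred acceptance produces stable matchings -/

section TopChoices

variable {n : ℕ} (r : Fin n → Fin n → Prop) [IsStrictTotalOrder (Fin n) r]

theorem exists_best {A : Set (Fin n)} (hA : A.Nonempty) : ∃ b ∈ A, ∀ t ∈ A, ¬ r t b := by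
  have wf : WellFounded r := Finite.wellFounded_of_trans_of_irrefl _
  obtain ⟨b, hb, h⟩ := wf.has_min A hA
  exact ⟨b, hb, h⟩

theorem exists_worst {A : Set (Fin n)} (hA : A.Nonempty) : ∃ b ∈ A, ∀ t ∈ A, ¬ r b t := by
  have wf : WellFounded (Function.swap r) := Finite.wellFounded_of_trans_of_irrefl _
  obtain ⟨b, hb, h⟩ := wf.has_min A hA
  exact ⟨b, hb, h⟩

/-- A set with at least `c` elements has at least `c` elements among its top `c` ones. -/
theorem le_ncard_top {A : Set (Fin n)} {c : ℕ} (h : c ≤ A.ncard) :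
    c ≤ {t ∈ A | {t' ∈ A | r t' t}.ncard < c}.ncard := by
  by_contra! hlt
  set B := {t ∈ A | {t' ∈ A | r t' t}.ncard < c} with hB
  have hne : (A \ B).Nonempty := by
    rw [Set.nonempty_iff_ne_empty]
    intro h0
    have h1 := Set.ncard_le_ncard (Set.sdiff_eq_empty.1 h0) B.toFinite
    omega
  -- Everything in `A` that beats the best element outside `B` lies in `B`, so fewer than `c`
  -- elements beat it and it belongs to `B` after all.
  obtain ⟨b, hb, hbest⟩ := exists_best r hne
  refine hb.2 ⟨hb.1, lt_of_le_of_lt (Set.ncard_le_ncard ?_ B.toFinite) hlt⟩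
  intro t ht
  by_contra htB
  exact hbest t ⟨ht.1, htB⟩ ht.2

/-- At most `c` elements are among the top `c` ones. -/
theorem ncard_top_le (A : Set (Fin n)) (c : ℕ) :
    {t ∈ A | {t' ∈ A | r t' t}.ncard < c}.ncard ≤ c := by
  set B := {t ∈ A | {t' ∈ A | r t' t}.ncard < c} with hB
  rcases B.eq_empty_or_nonempty with h0 | hne
  · simp [h0]
  obtain ⟨b, hb, hworst⟩ := exists_worst r hne
  have h1 : B ⊆ insert b {t' ∈ A | r t' b} := by
    intro t ht
    by_cases htb : t = b
    · exact Or.inl htb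
    · right
      refine ⟨ht.1, ?_⟩
      by_contra h
      exact htb (Std.Trichotomous.trichotomous (r := r) t b h (hworst t ht))
  have h2 := Set.ncard_le_ncard h1 (Set.toFinite _)
  have h3 := Set.ncard_insert_le b {t' ∈ A | r t' b}
  have h4 := hb.2
  omega

end TopChoices

/-- An increasing chain of subsets of a finite type stabilises, so the union is itself a stage of
the algorithm. -/
theorem exists_iterate_eq_iUnion {α : Type*} [Finite α] {f : Set α → Set α} (hf : ∀ R, R ⊆ f R) :
    ∃ k, f^[k] ∅ = ⋃ k : ℕ, f^[k] ∅ := by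
  have hmono : Monotone fun k : ℕ => f^[k] ∅ := monotone_nat_of_le_succ fun k => by
    rw [Function.iterate_succ_apply']
    exact hf _
  obtain ⟨k, hk⟩ := WellFoundedGT.monotone_chain_condition (α := Set α) ⟨_, hmono⟩
  refine ⟨k, Set.Subset.antisymm (Set.subset_iUnion (fun k : ℕ => f^[k] ∅) k) ?_⟩
  refine Set.iUnion_subset fun l => ?_
  rcases le_total k l with h | h
  · exact (hk l h).ge
  · exact hmono h

theorem apply_iUnion_iterate {α : Type*} [Finite α] {f : Set α → Set α} (hf : ∀ R, R ⊆ f R) :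
    f (⋃ k : ℕ, f^[k] ∅) = ⋃ k : ℕ, f^[k] ∅ := by
  obtain ⟨k, hk⟩ := exists_iterate_eq_iUnion hf
  refine Set.Subset.antisymm ?_ (hf _)
  rw [← hk, ← Function.iterate_succ_apply' (f := f), hk]
  exact Set.subset_iUnion (fun k : ℕ => f^[k] ∅) (k + 1)

theorem iUnion_iterate_induction {α : Type*} [Finite α] {f : Set α → Set α} (hf : ∀ R, R ⊆ f R)
    {Q : Set α → Prop} (h0 : Q ∅) (hstep : ∀ R, Q R → Q (f R)) : Q (⋃ k : ℕ, f^[k] ∅) := by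
  obtain ⟨k, hk⟩ := exists_iterate_eq_iUnion hf
  rw [← hk]
  clear hk
  induction k with
  | zero => exact h0
  | succ k ih =>
    rw [Function.iterate_succ_apply']
    exact hstep _ ih

namespace Market

variable {n m : ℕ} (I : Market n m)

theorem studentPrefers_trans {s : Fin n} {a b c : Option (Fin m)} (h : I.studentPrefers s a b)
    (h' : I.studentPrefers s b c) : I.studentPrefers s a c :=
  (I.studentPrefers_order s).toIsStrictOrder.toIsTrans.trans _ _ _ h h'

theorem studentPrefers_irrefl (s : Fin n) (a : Option (Fin m)) : ¬ I.studentPrefers s a a :=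
  (I.studentPrefers_order s).toIsStrictOrder.toIrrefl.irrefl a

theorem studentPrefers_of_ne {s : Fin n} {a b : Option (Fin m)} (h : a ≠ b)
    (h' : ¬ I.studentPrefers s b a) : I.studentPrefers s a b := by
  by_contra h2
  exact h ((I.studentPrefers_order s).toTrichotomous.trichotomous a b h2 h')

/-- A student has a favourite university in every nonempty set. -/
theorem exists_favourite (s : Fin n) {A : Set (Fin m)} (hA : A.Nonempty) :
    ∃ u ∈ A, ∀ v ∈ A, v ≠ u → I.studentPrefers s (some u) (some v) := by
  have := I.studentPrefers_order s
  have wf : WellFounded (I.studentPrefers s) := Finite.wellFounded_of_trans_of_irrefl _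
  obtain ⟨a, ⟨u, hu, rfl⟩, h⟩ := wf.has_min (some '' A) (hA.image _)
  refine ⟨u, hu, fun v hv hne => I.studentPrefers_of_ne ?_ (h _ ⟨v, hv, rfl⟩)⟩
  exact fun h => hne (Option.some_injective _ h).symm

theorem proposes_unique {R : Set (Fin n × Fin m)} {s : Fin n} {u v : Fin m}
    (hu : I.Proposes R s u) (hv : I.Proposes R s v) : u = v := by
  by_contra h
  exact I.studentPrefers_irrefl s _
    (I.studentPrefers_trans (hu.2.2 v (Ne.symm h) hv.2.1) (hv.2.2 u h hu.2.1))

/-- A student who has not been rejected by `u` but applies to it proposes to `u` or a better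
university. -/
theorem exists_proposes {R : Set (Fin n × Fin m)} {s : Fin n} {u : Fin m} (h : I.Applies s u)
    (hR : (s, u) ∉ R) : ∃ v, I.Proposes R s v ∧ (u ≠ v → I.studentPrefers s (some v) (some u)) := by
  obtain ⟨v, hv, hbest⟩ := I.exists_favourite s (A := {v | (s, v) ∉ R}) ⟨u, hR⟩
  refine ⟨v, ⟨?_, hv, fun w hw hwR => hbest w hwR hw⟩, fun hne => hbest u hR hne⟩
  by_cases huv : u = v
  · exact huv ▸ h
  · exact I.studentPrefers_trans (hbest u hR huv) h

theorem subset_studentRound (R : Set (Fin n × Fin m)) : R ⊆ I.studentRound R :=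
  Set.subset_union_left

theorem studentRejections_fixed :
    I.studentRound I.studentRejections = I.studentRejections :=
  apply_iUnion_iterate I.subset_studentRound

/-- A university that has rejected a student gets at least `capacity` better proposals. -/
theorem capacity_le_of_mem_studentRejections {s : Fin n} {u : Fin m}
    (h : (s, u) ∈ I.studentRejections) :
    I.capacity ≤ {t | I.Proposes I.studentRejections t u ∧ I.schoolPrefers u t s}.ncard := by
  refine iUnion_iterate_induction I.subset_studentRound
    (Q := fun R => ∀ s u, (s, u) ∈ R →
      I.capacity ≤ {t | I.Proposes R t u ∧ I.schoolPrefers u t s}.ncard)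
    (fun _ _ h => absurd h (Set.notMem_empty _)) (fun R hR s u hsu => ?_) s u h
  have := I.schoolPrefers_order u
  have h1 : I.capacity ≤ {t | I.Proposes R t u ∧ I.schoolPrefers u t s}.ncard := by
    rcases hsu with h | h
    · exact hR s u h
    · exact h.2
  -- The top `capacity` proposers better than `s` survive the round: anyone who beats one of them
  -- also beats `s`.
  refine (le_ncard_top (I.schoolPrefers u) h1).trans (Set.ncard_le_ncard ?_ (Set.toFinite _))
  rintro t ⟨⟨ht1, ht2⟩, ht3⟩
  refine ⟨⟨ht1.1, ?_, fun v hv hvR => ht1.2.2 v hv fun h => hvR (Or.inl h)⟩, ht2⟩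
  rintro (h | ⟨-, h⟩)
  · exact ht1.2.1 h
  · refine absurd (h.trans (Set.ncard_le_ncard ?_ (Set.toFinite _))) (not_le.2 ht3)
    rintro t' ⟨ht', ht''⟩
    exact ⟨⟨ht', _root_.trans_of (I.schoolPrefers u) ht'' ht2⟩, ht''⟩

theorem studentDA_eq_some {s : Fin n} {u : Fin m} :
    I.studentDA s = some u ↔ I.Proposes I.studentRejections s u := by
  rw [studentDA]
  split_ifs with h
  · rw [Option.some_inj]
    exact ⟨fun h' => h' ▸ h.choose_spec, fun h' => I.proposes_unique h.choose_spec h'⟩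
  · simp only [false_iff]
    exact fun h' => h ⟨u, h'⟩

/-- The student-proposing algorithm produces a stable matching. -/
theorem isStable_studentDA : I.IsStable I.studentDA := by
  have hcap : I.IsMatching I.studentDA := by
    intro u
    have := I.schoolPrefers_order u
    refine le_trans (Set.ncard_le_ncard ?_ (Set.toFinite _)) (ncard_top_le (I.schoolPrefers u)
      {t | I.Proposes I.studentRejections t u} I.capacity)
    intro s hs
    have hs' := I.studentDA_eq_some.1 hs
    refine ⟨hs', ?_⟩
    by_contra h
    refine hs'.2.1 ?_
    rw [← I.studentRejections_fixed]
    exact Or.inr ⟨hs', not_lt.1 h⟩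
  refine ⟨hcap, fun s hs => ?_, ?_⟩
  · rcases h : I.studentDA s with _ | u
    · rw [h] at hs
      exact I.studentPrefers_irrefl s _ hs
    · rw [h] at hs
      exact I.studentPrefers_irrefl s _
        (I.studentPrefers_trans hs (I.studentDA_eq_some.1 h).1)
  · rintro s u ⟨hpref, hblock⟩
    have := I.schoolPrefers_order u
    have happ : I.Applies s u := by
      rcases h : I.studentDA s with _ | v
      · rwa [h] at hpref
      · rw [h] at hpref
        exact I.studentPrefers_trans hpref (I.studentDA_eq_some.1 h).1
    have hrej : (s, u) ∈ I.studentRejections := by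
      by_contra hR
      obtain ⟨v, hv, h1⟩ := I.exists_proposes happ hR
      rw [I.studentDA_eq_some.2 hv] at hpref
      by_cases huv : u = v
      · subst huv
        exact I.studentPrefers_irrefl s _ hpref
      · exact I.studentPrefers_irrefl s _ (I.studentPrefers_trans hpref (h1 huv))
    have h1 := I.capacity_le_of_mem_studentRejections hrej
    have hsub : {t | I.Proposes I.studentRejections t u ∧ I.schoolPrefers u t s} ⊆
        {t | I.studentDA t = some u} := fun t ht => I.studentDA_eq_some.2 ht.1
    -- The better proposers already fill `u`, so it has neither an empty seat nor a student worse
    -- than `s`.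
    have heq := Set.eq_of_subset_of_ncard_le hsub ((hcap u).trans h1) (Set.toFinite _)
    rcases hblock with h | ⟨t, ht, hst⟩
    · rw [← heq] at h
      omega
    · have ht' : t ∈ {t | I.studentDA t = some u} := ht
      rw [← heq] at ht'
      exact _root_.irrefl_of (I.schoolPrefers u) s (_root_.trans_of (I.schoolPrefers u) hst ht'.2)

theorem subset_schoolRound (R : Set (Fin n × Fin m)) : R ⊆ I.schoolRound R :=
  Set.subset_union_left

theorem schoolRejections_fixed : I.schoolRound I.schoolRejections = I.schoolRejections :=
  apply_iUnion_iterate I.subset_schoolRound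

theorem offers_unique {s : Fin n} {u v : Fin m} (hu : I.Offers I.schoolRejections u s)
    (hv : I.Offers I.schoolRejections v s) : u = v := by
  by_contra h
  by_cases h1 : I.studentPrefers s (some u) (some v)
  · refine hv.2.1 ?_
    rw [← I.schoolRejections_fixed]
    exact Or.inr ⟨hv, u, hu, h1⟩
  · refine hu.2.1 ?_
    rw [← I.schoolRejections_fixed]
    refine Or.inr ⟨hu, v, hv, I.studentPrefers_of_ne ?_ h1⟩
    exact fun h2 => h (Option.some_injective _ h2).symm

theorem schoolDA_eq_some {s : Fin n} {u : Fin m} :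
    I.schoolDA s = some u ↔ I.Offers I.schoolRejections u s := by
  rw [schoolDA]
  split_ifs with h
  · rw [Option.some_inj]
    exact ⟨fun h' => h' ▸ h.choose_spec, fun h' => I.offers_unique h.choose_spec h'⟩
  · simp only [false_iff]
    exact fun h' => h ⟨u, h'⟩

/-- A student who has rejected an offer has a better one. -/
theorem exists_offer_of_mem_schoolRejections {s : Fin n} {u : Fin m}
    (h : (s, u) ∈ I.schoolRejections) :
    ∃ v, I.Offers I.schoolRejections v s ∧ I.studentPrefers s (some v) (some u) := by
  refine iUnion_iterate_induction I.subset_schoolRound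
    (Q := fun R => ∀ s u, (s, u) ∈ R → ∃ v, I.Offers R v s ∧ I.studentPrefers s (some v) (some u))
    (fun _ _ h => absurd h (Set.notMem_empty _)) (fun R hR s u hsu => ?_) s u h
  obtain ⟨v, hv, hvu⟩ : ∃ v, I.Offers R v s ∧ I.studentPrefers s (some v) (some u) := by
    rcases hsu with h | h
    · exact hR s u h
    · exact h.2
  obtain ⟨b, hb, hbest⟩ := I.exists_favourite s (A := {v | I.Offers R v s}) ⟨v, hv⟩
  refine ⟨b, ⟨hb.1, ?_, ?_⟩, ?_⟩
  · rintro (h | ⟨-, y, hy, hyb⟩)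
    · exact hb.2.1 h
    · by_cases hne : y = b
      · subst hne
        exact I.studentPrefers_irrefl s _ hyb
      · exact I.studentPrefers_irrefl s _ (I.studentPrefers_trans hyb (hbest y hy hne))
  -- New rejections only remove competitors, so an offer persists until it is rejected.
  · refine lt_of_le_of_lt (Set.ncard_le_ncard ?_ (Set.toFinite _)) hb.2.2
    rintro t ⟨h1, h2, h3⟩
    exact ⟨h1, fun h => h2 (Or.inl h), h3⟩
  · by_cases hne : v = b
    · exact hne ▸ hvu
    · exact I.studentPrefers_trans (hbest v hv hne) hvu

/-- The school-proposing algorithm produces a stable matching. -/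
theorem isStable_schoolDA : I.IsStable I.schoolDA := by
  have hcap : I.IsMatching I.schoolDA := by
    intro u
    have := I.schoolPrefers_order u
    refine le_trans (Set.ncard_le_ncard ?_ (Set.toFinite _)) (ncard_top_le (I.schoolPrefers u)
      {t | I.Applies t u ∧ (t, u) ∉ I.schoolRejections} I.capacity)
    intro s hs
    obtain ⟨h1, h2, h3⟩ := I.schoolDA_eq_some.1 hs
    refine ⟨⟨h1, h2⟩, ?_⟩
    simpa only [Set.mem_ofPred_eq, and_assoc] using h3
  refine ⟨hcap, fun s hs => ?_, ?_⟩
  · rcases h : I.schoolDA s with _ | u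
    · rw [h] at hs
      exact I.studentPrefers_irrefl s _ hs
    · rw [h] at hs
      exact I.studentPrefers_irrefl s _
        (I.studentPrefers_trans hs (I.schoolDA_eq_some.1 h).1)
  · rintro s u ⟨hpref, hblock⟩
    have := I.schoolPrefers_order u
    have happ : I.Applies s u := by
      rcases h : I.schoolDA s with _ | v
      · rwa [h] at hpref
      · rw [h] at hpref
        exact I.studentPrefers_trans hpref (I.schoolDA_eq_some.1 h).1
    have hrej : (s, u) ∉ I.schoolRejections := by
      intro hR
      obtain ⟨v, hv, h1⟩ := I.exists_offer_of_mem_schoolRejections hR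
      rw [I.schoolDA_eq_some.2 hv] at hpref
      exact I.studentPrefers_irrefl s _ (I.studentPrefers_trans hpref h1)
    have hno : ¬ I.Offers I.schoolRejections u s := by
      intro h
      rw [I.schoolDA_eq_some.2 h] at hpref
      exact I.studentPrefers_irrefl s _ hpref
    -- Without an offer, `s` is beaten by `capacity` available applicants; the top ones among them
    -- have offers and fill `u`.
    have h1 : I.capacity ≤ {t | (I.Applies t u ∧ (t, u) ∉ I.schoolRejections) ∧
        I.schoolPrefers u t s}.ncard := by
      by_contra h
      refine hno ⟨happ, hrej, ?_⟩
      simpa only [and_assoc] using not_le.1 h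
    have h2 := le_ncard_top (I.schoolPrefers u) h1
    have hsub : {t ∈ {t | (I.Applies t u ∧ (t, u) ∉ I.schoolRejections) ∧
        I.schoolPrefers u t s} | {t' ∈ {t | (I.Applies t u ∧ (t, u) ∉ I.schoolRejections) ∧
        I.schoolPrefers u t s} | I.schoolPrefers u t' t}.ncard < I.capacity} ⊆
        {t | I.schoolDA t = some u} := by
      rintro t ⟨⟨⟨ht1, ht2⟩, ht3⟩, ht4⟩
      refine I.schoolDA_eq_some.2 ⟨ht1, ht2,
        lt_of_le_of_lt (Set.ncard_le_ncard ?_ (Set.toFinite _)) ht4⟩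
      rintro t' ⟨a, b, c⟩
      exact ⟨⟨⟨a, b⟩, _root_.trans_of (I.schoolPrefers u) c ht3⟩, c⟩
    have heq := Set.eq_of_subset_of_ncard_le hsub ((hcap u).trans h2) (Set.toFinite _)
    rcases hblock with h | ⟨t, ht, hst⟩
    · rw [← heq] at h
      omega
    · have ht' : t ∈ {t | I.schoolDA t = some u} := ht
      rw [← heq] at ht'
      exact _root_.irrefl_of (I.schoolPrefers u) s
        (_root_.trans_of (I.schoolPrefers u) hst ht'.1.2)

end Market

/-! ### The random market -/

section Random

variable {n m : ℕ}

instance : MeasurableSingletonClass (Equiv.Perm (Fin n)) := ⟨fun _ => trivial⟩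

instance (ω : Outcome n m) (u : Fin m) : IsStrictTotalOrder (Fin n) (ω.Ranks u) :=
  (ω.market 0 0).schoolPrefers_order u

/-- A signal depends on the list only through whether the university is at place `0`, and neither
exchanged university is. -/
theorem ranks_switch (P : Fin n → Equiv.Perm (Fin m))
    (q : (Fin m → Fin n → ℝ × ℝ) × (Fin m → Equiv.Perm (Fin n))) {s : Fin n} {u x : Fin m}
    (hu : 0 < (P s u : ℕ)) (hx : 0 < (P s x : ℕ)) :
    Outcome.Ranks ((switch P s u x, q) : Outcome n m) = Outcome.Ranks ((P, q) : Outcome n m) := by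
  have h : ∀ v t, Outcome.signal ((switch P s u x, q) : Outcome n m) v t =
      Outcome.signal ((P, q) : Outcome n m) v t := by
    intro v t
    simp only [Outcome.signal]
    congr 1
    by_cases ht : t = s
    · subst ht
      rw [switch_self]
      rcases eq_or_ne v u with rfl | hvu
      · rw [Equiv.swap_apply_left]
        simp [hu.ne', hx.ne']
      rcases eq_or_ne v x with rfl | hvx
      · rw [Equiv.swap_apply_right]
        simp [hu.ne', hx.ne']
      rw [Equiv.swap_apply_of_ne_of_ne hvu hvx]
    · rw [switch_of_ne ht]
  funext v a b
  simp only [Outcome.Ranks, h]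

theorem measurable_ranks (P : Fin n → Equiv.Perm (Fin m)) :
    Measurable fun q : (Fin m → Fin n → ℝ × ℝ) × (Fin m → Equiv.Perm (Fin n)) =>
      Outcome.Ranks ((P, q) : Outcome n m) := by
  have hsig : ∀ u s, Measurable
      fun q : (Fin m → Fin n → ℝ × ℝ) × (Fin m → Equiv.Perm (Fin n)) =>
        Outcome.signal ((P, q) : Outcome n m) u s := by
    intro u s
    simp only [Outcome.signal]
    split_ifs <;> fun_prop
  refine measurable_pi_iff.2 fun u => measurable_pi_iff.2 fun s => measurable_pi_iff.2 fun t => ?_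
  have htie : Measurable fun q : (Fin m → Fin n → ℝ × ℝ) × (Fin m → Equiv.Perm (Fin n)) =>
      q.2 u s < q.2 u t :=
    (measurable_from_top (f := fun τ : Equiv.Perm (Fin n) => τ s < τ t)).comp
      ((measurable_pi_apply u).comp measurable_snd)
  exact ((measurableSet_lt (hsig u t) (hsig u s)).mem).or
    (((measurableSet_eq_fun (hsig u t) (hsig u s)).mem).and htie)

/-- Profiles and priority relations are finite in number, so events that depend on nothing else are
measurable; this permits Fubini. -/
theorem measurableSet_of_ranks
    (A : Set ((Fin n → Equiv.Perm (Fin m)) × (Fin m → Fin n → Fin n → Prop))) :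
    MeasurableSet {ω : Outcome n m | (ω.1, ω.Ranks) ∈ A} := by
  have h : {ω : Outcome n m | (ω.1, ω.Ranks) ∈ A} = ⋃ P : Fin n → Equiv.Perm (Fin m),
      {P} ×ˢ ((fun q => Outcome.Ranks ((P, q) : Outcome n m)) ⁻¹' {R | (P, R) ∈ A}) := by
    ext ⟨P, q⟩
    simp
  rw [h]
  exact MeasurableSet.iUnion fun P => (measurableSet_singleton P).prod
    (measurable_ranks P (Set.toFinite _).measurableSet)

theorem law_many_returning_le (D D' : Measure ℝ) [IsProbabilityMeasure D]
    [IsProbabilityMeasure D'] {K L : ℕ} (hK : K ≤ m) (hpos : 0 < m * lonelyProb K m n) {t : ℝ}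
    (ht : 0 < t) :
    law D D' n m {ω | t < (returning ω.Ranks K L ω.1).card} ≤
      ENNReal.ofReal (4 / (m * lonelyProb K m n) + 2 / (t * lonelyProb K m n)) := by
  classical
  have hB : MeasurableSet {ω : Outcome n m | t < (returning ω.Ranks K L ω.1).card} :=
    measurableSet_of_ranks {z | t < (returning z.2 K L z.1).card}
  rw [law, Measure.prod_apply_symm hB]
  -- For fixed signals and tie-breaks `q`, the counting bound holds for the uniform profile,
  -- whatever the signal laws.
  refine (lintegral_mono (g := fun _ => ENNReal.ofReal
    (4 / (m * lonelyProb K m n) + 2 / (t * lonelyProb K m n))) fun q => ?_).trans_eq (by simp)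
  have h1 := card_many_returning_le (L := L) K hK hpos
    (R := fun P => Outcome.Ranks ((P, q) : Outcome n m))
    (fun P s u x hu hx => ranks_switch P q hu hx) ht
  have hN : (0 : ℝ) < Fintype.card (Fin n → Equiv.Perm (Fin m)) := by
    exact_mod_cast Fintype.card_pos
  have h2 : ((fun P => (P, q)) ⁻¹' {ω : Outcome n m | t < (returning ω.Ranks K L ω.1).card}) =
      ((Finset.univ.filter fun P : Fin n → Equiv.Perm (Fin m) =>
        t < (returning (Outcome.Ranks ((P, q) : Outcome n m)) K L P).card : Finset _) :
        Set (Fin n → Equiv.Perm (Fin m))) := by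
    ext P
    simp
  rw [uniformOn_univ, h2, Measure.count_apply_finset, ENNReal.div_le_iff (by simp) (by simp),
    ← ENNReal.ofReal_natCast, ← ENNReal.ofReal_natCast, ← ENNReal.ofReal_mul' (Nat.cast_nonneg _)]
  refine ENNReal.ofReal_le_ofReal ?_
  rw [mul_comm]
  exact h1

theorem exp_le_lonelyProb {K : ℕ} {M : ℝ} (hM : 0 < M) (hm : M * n / 2 ≤ m) (hm0 : 0 < m)
    (hK : 2 * K ≤ m) : Real.exp (-(4 * K / M)) ≤ lonelyProb K m n := by
  have hm' : (0 : ℝ) < m := by exact_mod_cast hm0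
  have hK' : 2 * (K : ℝ) ≤ m := by exact_mod_cast hK
  -- For `0 ≤ y ≤ 1/2` one has `(1 + 2y)(1 - y) ≥ 1`.
  have h1 : Real.exp (-(2 * (K / m))) ≤ 1 - (K : ℝ) / m := by
    set y := (K : ℝ) / m with hy
    have hy0 : 0 ≤ y := by positivity
    have hy1 : y ≤ 1 / 2 := by
      rw [hy, div_le_div_iff₀ hm' two_pos]
      linarith
    have h2 : 1 + 2 * y ≤ Real.exp (2 * y) := by linarith [Real.add_one_le_exp (2 * y)]
    rw [Real.exp_neg, inv_le_comm₀ (Real.exp_pos _) (by linarith)]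
    refine le_trans ?_ h2
    rw [inv_le_iff_one_le_mul₀ (by linarith)]
    nlinarith
  rw [lonelyProb]
  refine le_trans ?_ (pow_le_pow_left₀ (Real.exp_pos _).le h1 n)
  rw [← Real.exp_nat_mul, Real.exp_le_exp]
  have h3 : (n : ℝ) * (2 * (K / m)) ≤ 4 * K / M := by
    rw [mul_div_assoc', mul_div_assoc', div_le_div_iff₀ hm' hM]
    have hK0 : (0 : ℝ) ≤ K := Nat.cast_nonneg _
    nlinarith
  linarith

/-- The number of students on whom two stable matchings differ is controlled by the number of
returning rejection chains. -/
theorem disagreement_le_of_isStable {ω : Outcome n m} {K L : ℕ} {μ ν : Fin n → Option (Fin m)}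
    (hμ : (ω.market K L).IsStable μ) (hν : (ω.market K L).IsStable ν) :
    (disagreement μ ν : ℝ) ≤ L * (returning ω.Ranks K L ω.1).card := by
  exact_mod_cast disagreement_le (listStable_of_isStable hμ) (listStable_of_isStable hν)

theorem disagreement_le_card (μ ν : Fin n → Option (Fin m)) : disagreement μ ν ≤ n := by
  rw [disagreement]
  exact (Set.ncard_le_ncard (Set.subset_univ _) (Set.toFinite _)).trans_eq (by simp)

/-- The main estimate for one market size. -/
theorem law_disagreement_le (D D' : Measure ℝ) [IsProbabilityMeasure D]
    [IsProbabilityMeasure D'] {K L : ℕ} {M : ℝ} (hM : 0 < M) (hn : 0 < n) (hm : M * n / 2 ≤ m)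
    (hK : 2 * K ≤ m) {c δ : ℝ} (hc : c = Real.exp (-(4 * K / M)))
    (hδ : δ = 8 / (M * n * c) + √(2 * (L + 1) / (n * c))) :
    law D D' n m {ω | ∃ μ ν : Fin n → Option (Fin m), (ω.market K L).IsStable μ ∧
      (ω.market K L).IsStable ν ∧ δ * n < disagreement μ ν} ≤ ENNReal.ofReal δ := by
  have hn' : (0 : ℝ) < n := by exact_mod_cast hn
  have hm' : (0 : ℝ) < m := lt_of_lt_of_le (by positivity) hm
  have hb : c ≤ lonelyProb K m n := hc ▸ exp_le_lonelyProb hM hm (by exact_mod_cast hm') hK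
  have hc0 : 0 < c := hc ▸ Real.exp_pos _
  have hL : (0 : ℝ) < L + 1 := by positivity
  set B := √(2 * ((L : ℝ) + 1) / (n * c)) with hBdef
  have hB : 0 < B := Real.sqrt_pos.2 (by positivity)
  have hA : 0 < 8 / (M * n * c) := by positivity
  have hδ0 : 0 < δ := by linarith
  -- The threshold for returning chains; `L + 1` instead of `L` also covers `L = 0`.
  have ht : 0 < δ * n / (L + 1) := by positivity
  have hpos : 0 < m * lonelyProb K m n := mul_pos hm' (hc0.trans_le hb)
  calc law D D' n m {ω | ∃ μ ν : Fin n → Option (Fin m), (ω.market K L).IsStable μ ∧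
        (ω.market K L).IsStable ν ∧ δ * n < disagreement μ ν}
      ≤ law D D' n m {ω | δ * n / (L + 1) < (returning ω.Ranks K L ω.1).card} := by
        refine measure_mono ?_
        rintro ω ⟨μ, ν, hμ, hν, hlt⟩
        have h1 := disagreement_le_of_isStable hμ hν
        simp only [Set.mem_ofPred_eq]
        rw [div_lt_iff₀ hL]
        have h2 : (0 : ℝ) ≤ (returning ω.Ranks K L ω.1).card := Nat.cast_nonneg _
        linarith
    _ ≤ _ := law_many_returning_le D D' (by omega) hpos ht
    _ ≤ ENNReal.ofReal δ := by
        refine ENNReal.ofReal_le_ofReal ?_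
        have h1 : 4 / (m * lonelyProb K m n) ≤ 8 / (M * n * c) := by
          have h2 : M * n / 2 * c ≤ m * lonelyProb K m n :=
            mul_le_mul hm hb hc0.le hm'.le
          rw [div_le_div_iff₀ hpos (by positivity)]
          linarith
        -- `B` solves `B * B = 2(L+1)/(nc)`: since `δ ≥ B`, the Markov term, which has `δ` in its
        -- denominator, is at most `B`.
        have h2 : 2 / (δ * n / (L + 1) * lonelyProb K m n) ≤ B := by
          have h3 : B * B = 2 * (L + 1) / (n * c) := Real.mul_self_sqrt (by positivity)
          have h4 : B * B * (n * c) = 2 * (L + 1) := by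
            rw [h3]
            field_simp
          have h5 : B * B * (n * c) ≤ B * δ * (n * lonelyProb K m n) := by
            refine mul_le_mul (mul_le_mul_of_nonneg_left (by linarith) hB.le)
              (mul_le_mul_of_nonneg_left hb hn'.le) (by positivity) (by positivity)
          rw [div_le_iff₀ (mul_pos ht (hc0.trans_le hb))]
          have h6 : B * (δ * n / (L + 1) * lonelyProb K m n) =
              B * δ * (n * lonelyProb K m n) / (L + 1) := by ring
          rw [h6, le_div_iff₀ hL]
          linarith
        linarith

end Random

end MatchingMarket

/-! ### The error sequence and the conclusion -/

theorem theorem2 (K L : ℕ) (M : ℝ) (hM : 0 < M) :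
    ∃ δ : ℕ → ℝ, Tendsto δ atTop (𝓝 0) ∧
      ∀ (D D' : Measure ℝ) [IsProbabilityMeasure D] [IsProbabilityMeasure D'] (n : ℕ),
        MatchingMarket.law D D' n ⌊M * n⌋₊
            {ω | ∃ μ ν : Fin n → Option (Fin ⌊M * n⌋₊),
              (ω.market K L).IsStable μ ∧ (ω.market K L).IsStable ν ∧
                δ n * n < MatchingMarket.disagreement μ ν} ≤ ENNReal.ofReal (δ n) ∧
        MatchingMarket.law D D' n ⌊M * n⌋₊
            {ω | δ n * n < MatchingMarket.disagreement
              (ω.market K L).schoolDA (ω.market K L).studentDA} ≤ ENNReal.ofReal (δ n) := by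
  classical
  set c := Real.exp (-(4 * K / M)) with hc
  have hc0 : 0 < c := Real.exp_pos _
  -- For small markets the value `1` makes the bad event empty, as at most `n` students can differ;
  -- `2 ≤ M * n` ensures that the floor is at least `M * n / 2`.
  let δ : ℕ → ℝ := fun n => if 2 * K ≤ ⌊M * n⌋₊ ∧ 2 ≤ M * n then
    8 / (M * n * c) + √(2 * (L + 1) / (n * c)) else 1
  have hMn : Tendsto (fun n : ℕ => M * (n : ℝ)) atTop atTop :=
    tendsto_natCast_atTop_atTop.const_mul_atTop hM
  refine ⟨δ, ?_, fun D D' _ _ n => ?_⟩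
  · have h1 : Tendsto (fun n : ℕ => 8 / (M * n * c) + √(2 * (L + 1) / (n * c))) atTop (𝓝 0) := by
      have h2 : Tendsto (fun n : ℕ => 8 / (M * n * c)) atTop (𝓝 0) :=
        tendsto_const_nhds.div_atTop (hMn.atTop_mul_const hc0)
      have h3 : Tendsto (fun n : ℕ => 2 * ((L : ℝ) + 1) / (n * c)) atTop (𝓝 0) :=
        tendsto_const_nhds.div_atTop (tendsto_natCast_atTop_atTop.atTop_mul_const hc0)
      simpa using h2.add h3.sqrt
    refine h1.congr' ?_
    filter_upwards [(tendsto_nat_floor_atTop.comp hMn).eventually_ge_atTop (2 * K),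
      hMn.eventually_ge_atTop 2] with n h2 h3
    exact (if_pos ⟨h2, h3⟩).symm
  · have key : MatchingMarket.law D D' n ⌊M * n⌋₊
        {ω | ∃ μ ν : Fin n → Option (Fin ⌊M * n⌋₊),
          (ω.market K L).IsStable μ ∧ (ω.market K L).IsStable ν ∧
            δ n * n < MatchingMarket.disagreement μ ν} ≤ ENNReal.ofReal (δ n) := by
      by_cases h : 2 * K ≤ ⌊M * n⌋₊ ∧ 2 ≤ M * n
      · have hn : 0 < n := by
          rcases Nat.eq_zero_or_pos n with h0 | h0
          · have h2 := h.2
            rw [h0] at h2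
            norm_num at h2
          · exact h0
        have hfl : M * n / 2 ≤ (⌊M * n⌋₊ : ℝ) := by
          have h1 := Nat.lt_floor_add_one (M * n)
          linarith [h.2]
        exact MatchingMarket.law_disagreement_le D D' hM hn hfl h.1 hc (if_pos h)
      · have hδ : δ n = 1 := if_neg h
        have hempty : {ω : MatchingMarket.Outcome n ⌊M * n⌋₊ |
            ∃ μ ν : Fin n → Option (Fin ⌊M * n⌋₊),
            (ω.market K L).IsStable μ ∧ (ω.market K L).IsStable ν ∧
              δ n * n < MatchingMarket.disagreement μ ν} = ∅ := by
          rw [Set.eq_empty_iff_forall_notMem]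
          rintro ω ⟨μ, ν, -, -, hlt⟩
          rw [hδ, one_mul] at hlt
          have h1 := MatchingMarket.disagreement_le_card μ ν
          have h2 : n < MatchingMarket.disagreement μ ν := by exact_mod_cast hlt
          omega
        rw [hempty, measure_empty]
        exact zero_le
    refine ⟨key, (measure_mono ?_).trans key⟩
    intro ω hω
    exact ⟨_, _, (ω.market K L).isStable_schoolDA, (ω.market K L).isStable_studentDA, hω⟩
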